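/- **Theorem.** A field $F$ is called a *$C_1$-field* if every homogeneous polynomial $f(x_1,\dots,x_n)$ over $F$ of degree $d$ with $0<d<n$ has a non-trivial zero in $F^n$. For a field extension $K/F$ and an associative (unital) $F$-algebra $A$ write $A_K := K\otimes_F A$. Given an $A_K$-module $M$, an intermediate field $F\subset K_0\subset K$ is a *field of definition* of $M$ if there is an $A_{K_0}$-module $M_0$ with $M\cong K\otimes_{K_0}M_0$ as $A_K$-modules; it is *minimal* if it is contained in every field of definition $L$ of $M$, $F\subset L\subset K$. Let $F$ be a $C_1$-field, $A$ a finite-dimensional associative $F$-algebra, $K/F$ a separable algebraic field extension, and $M$ a finitely generated $A_K$-module. Then $M$ has a minimal field of definition $F\subset K_0\subset K$; it is unique, and $[K_0:F]<\infty$. If moreover $K/F$ is Galois, let $\operatorname{Gal}(K/F)$ act on the set of isomorphism classes of $A_K$-modules by $g\colon [N]\mapsto[{}^gN]$, where ${}^gN := K\otimes_g N$ is the extension of scalars of $N$ along $g\colon K\to K$, and let $G_M=\{g\in\operatorname{Gal}(K/F) : {}^gM\cong M\}$ be the stabilizer of $[M]$. Then $K_0=K^{G_M}$, the fixed field of $G_M$.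 -/

import Mathlib

open scoped TensorProduct

noncomputable section

/-- `F` is a `C₁`-field: every homogeneous polynomial over `F` of positive degree `d` in `n > d`
variables has a non-trivial zero in `F ^ n`. -/
def IsC1Field (F : Type*) [Field F] : Prop :=
  ∀ (n d : ℕ) (f : MvPolynomial (Fin n) F), 0 < d → d < n → f.IsHomogeneous d →
    ∃ x : Fin n → F, x ≠ 0 ∧ MvPolynomial.eval x f = 0

/-- The `L`-vector space `N_L = L ⊗[E] N`. It is a type synonym, so that it can carry the
`A_L`-module structure below. -/
def ScalarExt (E L N : Type*) [Field E] [Field L] [Algebra E L] [AddCommGroup N] [Module E N] :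
    Type _ := L ⊗[E] N

instance (E L N : Type*) [Field E] [Field L] [Algebra E L] [AddCommGroup N] [Module E N] :
    AddCommGroup (ScalarExt E L N) := inferInstanceAs (AddCommGroup (L ⊗[E] N))

instance (E L N : Type*) [Field E] [Field L] [Algebra E L] [AddCommGroup N] [Module E N] :
    Module L (ScalarExt E L N) := inferInstanceAs (Module L (L ⊗[E] N))

section BaseChange

variable (F A E L N : Type*) [Field F] [Ring A] [Algebra F A]
  [Field E] [Algebra F E] [Field L] [Algebra F L] [Algebra E L] [IsScalarTower F E L]
  [AddCommGroup N] [Module E N] [Module (E ⊗[F] A) N] [IsScalarTower E (E ⊗[F] A) N]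

/-- The action of `A` on `L ⊗[E] N` for an `A_E`-module `N`: `a • (l ⊗ n) = l ⊗ (1 ⊗ a) • n`. -/
def baseChangeActionAux : A →ₐ[F] Module.End L (L ⊗[E] N) :=
  (((Module.End.baseChangeHom E L N).comp
    (Algebra.lsmul E E N : E ⊗[F] A →ₐ[E] Module.End E N)).restrictScalars F).comp
      (Algebra.TensorProduct.includeRight : A →ₐ[F] E ⊗[F] A)

/-- The action of `A_L = L ⊗[F] A` on `L ⊗[E] N` for an `A_E`-module `N`, determined by
`(l ⊗ a) • (l' ⊗ n) = l * l' ⊗ (1 ⊗ a) • n`. -/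
def baseChangeAction : L ⊗[F] A →ₐ[L] Module.End L (L ⊗[E] N) :=
  Algebra.TensorProduct.lift (Algebra.ofId L (Module.End L (L ⊗[E] N)))
    (baseChangeActionAux F A E L N) (fun l _ ↦ Algebra.commutes l _)

variable {F A E L N} in
theorem baseChangeAction_tmul_tmul (l l' : L) (a : A) (n : N) :
    baseChangeAction F A E L N (l ⊗ₜ a) (l' ⊗ₜ n) = (l * l') ⊗ₜ (((1 : E) ⊗ₜ[F] a) • n) := by
  have h : baseChangeActionAux F A E L N a (l' ⊗ₜ n) = l' ⊗ₜ (((1 : E) ⊗ₜ[F] a) • n) := rfl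
  refine (LinearMap.congr_fun (Algebra.TensorProduct.lift_tmul _ _ _ l a) _).trans ?_
  rw [Module.End.mul_apply, h, Algebra.ofId_apply, Module.algebraMap_end_apply,
    TensorProduct.smul_tmul', smul_eq_mul]

/-- For an `A_E`-module `N`, the extension `N_L = L ⊗[E] N` is an `A_L`-module. -/
instance : Module (L ⊗[F] A) (ScalarExt E L N) :=
  Module.compHom (L ⊗[E] N) (baseChangeAction F A E L N).toRingHom

theorem scalarExt_smul_def (x : L ⊗[F] A) (y : ScalarExt E L N) :
    x • y = baseChangeAction F A E L N x y := rfl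

instance : IsScalarTower L (L ⊗[F] A) (ScalarExt E L N) where
  smul_assoc l x y := by
    simp only [scalarExt_smul_def, map_smul]
    rfl

end BaseChange

universe w

/-- `K₀` is a field of definition of the `A_K`-module `M` (that is, `M` descends to `K₀`): there is
an `A_{K₀}`-module `M₀` such that `M` and `(M₀)_K = K ⊗[K₀] M₀` are isomorphic as `A_K`-modules.
(The `K₀`-structure of `M₀` is the one induced from `A_{K₀}`. Since `M₀` embeds into `M`, it is
no restriction that `M₀` lives in the universe of `M`.) -/
def IsFieldOfDefinition {F : Type*} (A : Type*) {K : Type*} (M : Type w)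
    [Field F] [Ring A] [Algebra F A] [Field K] [Algebra F K]
    [AddCommGroup M] [Module (K ⊗[F] A) M] (K₀ : IntermediateField F K) : Prop :=
  ∃ (M₀ : Type w) (_ : AddCommGroup M₀) (_ : Module K₀ M₀) (_ : Module (K₀ ⊗[F] A) M₀)
    (_ : IsScalarTower K₀ (K₀ ⊗[F] A) M₀),
    Nonempty (M ≃ₗ[K ⊗[F] A] ScalarExt K₀ K M₀)

/-- A field of definition of `M` is minimal if it is contained in every field of definition. -/
def IsMinimalFieldOfDefinition {F : Type*} (A : Type*) {K : Type*} (M : Type w)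
    [Field F] [Ring A] [Algebra F A] [Field K] [Algebra F K]
    [AddCommGroup M] [Module (K ⊗[F] A) M] (K₀ : IntermediateField F K) : Prop :=
  IsFieldOfDefinition A M K₀ ∧ ∀ L : IntermediateField F K, IsFieldOfDefinition A M L → K₀ ≤ L

section GaloisAction

variable {F K : Type*} [Field F] [Field K] [Algebra F K]

/-- The field `K`, regarded as a `K`-algebra through the automorphism `g`. -/
def ConjField (_g : Gal(K/F)) : Type _ := K

variable (g : Gal(K/F))

instance : Field (ConjField g) := inferInstanceAs (Field K)

instance : Algebra F (ConjField g) := inferInstanceAs (Algebra F K)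

instance : Algebra K (ConjField g) := (g : K →+* K).toAlgebra

instance : IsScalarTower F K (ConjField g) :=
  IsScalarTower.of_algebraMap_eq fun x ↦ (g.commutes x).symm

variable (A M : Type*) [Ring A] [Algebra F A] [AddCommGroup M] [Module K M]
  [Module (K ⊗[F] A) M] [IsScalarTower K (K ⊗[F] A) M]

/-- The Galois conjugate `ᵍM = K ⊗_g M` of an `A_K`-module `M`: extension of scalars along
`g : K → K`. -/
def GaloisConj (g : Gal(K/F)) (M : Type*) [AddCommGroup M] [Module K M] : Type _ :=
  ScalarExt K (ConjField g) M

instance : AddCommGroup (GaloisConj g M) :=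
  inferInstanceAs (AddCommGroup (ScalarExt K (ConjField g) M))

instance : Module (K ⊗[F] A) (GaloisConj g M) :=
  inferInstanceAs (Module (ConjField g ⊗[F] A) (ScalarExt K (ConjField g) M))

/-- The bijection `M → ᵍM`, `m ↦ 1 ⊗ m`. -/
def toGaloisConj : M ≃+ GaloisConj g M :=
  ((TensorProduct.congr (LinearEquiv.ofBijective (Algebra.linearMap K (ConjField g)) g.bijective)
    (LinearEquiv.refl K M)).toAddEquiv.symm.trans (TensorProduct.lid K M).toAddEquiv).symm

theorem toGaloisConj_apply (m : M) :
    toGaloisConj g M m = ((1 : ConjField g) ⊗ₜ[K] m : ConjField g ⊗[K] M) := by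
  change (TensorProduct.congr _ _) ((TensorProduct.lid K M).symm m) = _
  rw [TensorProduct.lid_symm_apply, TensorProduct.congr_tmul]
  exact congrArg (fun x : ConjField g ↦ (x ⊗ₜ[K] m : ConjField g ⊗[K] M)) (map_one g)

theorem toGaloisConj_smul (k : K) (a : A) (m : M) :
    toGaloisConj g M ((k ⊗ₜ[F] a) • m) = (g k ⊗ₜ[F] a : K ⊗[F] A) • toGaloisConj g M m := by
  have h : (k ⊗ₜ[F] a : K ⊗[F] A) • m = k • (((1 : K) ⊗ₜ[F] a) • m) := by
    rw [← smul_assoc, TensorProduct.smul_tmul', smul_eq_mul, mul_one]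
  rw [toGaloisConj_apply, toGaloisConj_apply, h]
  refine Eq.trans ?_ (baseChangeAction_tmul_tmul (F := F) (A := A) (E := K) (L := ConjField g)
    (N := M) (g k) 1 a m).symm
  rw [← TensorProduct.smul_tmul, Algebra.smul_def]
  rfl

variable {g A M} in
/-- `ᵍM` and `M` are isomorphic if and only if `M` has a `g`-semilinear automorphism. -/
theorem nonempty_galoisConj_equiv_iff :
    Nonempty (GaloisConj g M ≃ₗ[K ⊗[F] A] M) ↔
      ∃ φ : M ≃+ M, ∀ (k : K) (a : A) (m : M), φ ((k ⊗ₜ[F] a) • m) = (g k ⊗ₜ[F] a) • φ m := by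
  constructor
  · rintro ⟨e⟩
    refine ⟨(toGaloisConj g M).trans e.toAddEquiv, fun k a m ↦ ?_⟩
    simp [toGaloisConj_smul]
  · rintro ⟨φ, hφ⟩
    let ψ : GaloisConj g M ≃+ M := (toGaloisConj g M).symm.trans φ
    refine ⟨{ ψ with map_smul' := fun x y ↦ ?_ }⟩
    change ψ (x • y) = x • ψ y
    obtain ⟨m, rfl⟩ := (toGaloisConj g M).surjective y
    induction x with
    | zero => simp
    | add x y hx hy => simp only [add_smul, map_add, hx, hy]
    | tmul k a =>
      obtain ⟨k, rfl⟩ := g.surjective k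
      rw [← toGaloisConj_smul]
      simp [ψ, hφ]

/-- The stabilizer of the isomorphism class of the `A_K`-module `M` under the Galois action
`[M] ↦ [ᵍM]` on isomorphism classes of `A_K`-modules. -/
def galoisStabilizer : Subgroup Gal(K/F) where
  carrier := {g | Nonempty (GaloisConj g M ≃ₗ[K ⊗[F] A] M)}
  one_mem' := nonempty_galoisConj_equiv_iff.2 ⟨AddEquiv.refl M, fun _ _ _ ↦ rfl⟩
  mul_mem' {g h} hg hh := by
    obtain ⟨φ, hφ⟩ := nonempty_galoisConj_equiv_iff.1 hg
    obtain ⟨ψ, hψ⟩ := nonempty_galoisConj_equiv_iff.1 hh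
    exact nonempty_galoisConj_equiv_iff.2 ⟨ψ.trans φ, fun k a m ↦ by simp [hφ, hψ]⟩
  inv_mem' {g} hg := by
    obtain ⟨φ, hφ⟩ := nonempty_galoisConj_equiv_iff.1 hg
    refine nonempty_galoisConj_equiv_iff.2 ⟨φ.symm, fun k a m ↦ φ.injective ?_⟩
    simp [hφ]

end GaloisAction

end

/-!
In a `K`-basis of `M`, an `F`-basis of `A` acts by a finite family `X` of matrices over `K`. A field
of definition of `M` is then a field over which `X` is defined up to simultaneous similarity
(`isFieldOfDefinition_iff`), and the stabilizer of `[M]` consists of the automorphisms `g` such that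
`X` and its conjugate under `g` are similar (`galoisStabilizer_eq_similarityStabilizer`).

Let `K / F` be Galois. If `X` is defined over `K₀`, then automorphisms fixing `K₀` stabilize `X`, so
`K₀` contains the fixed field of the stabilizer `G`. The point is that, over a `C₁`-field, `X` is
defined over this fixed field (`isDefinedOver_fixedField`). The field `K ^ G` is finite over `F`, as
the entries of `X` generate a finite extension, and therefore it is a `C₁`-field itself
(`IsC1Field.of_finiteDimensional`); a finite Galois extension `L` of it contains the entries of `X`.
By the theorem of Noether and Deuring (`AreSimilar.of_map`), `X` is similar to its conjugates over
`L`. So it remains to descend a module `M` over `L`, with `g`-semilinear automorphisms `φ g` for all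
`g` in the Galois group of `L / k`, to `k` (`exists_baseChange_equiv`). The `φ g` need not be a
group action, and the obstruction is a matter of Schur indices.

These are trivial since finite-dimensional division algebras over `C₁`-fields are commutative
(`IsC1Field.mul_comm`): the reduced norm of a central division algebra of degree `r` is a form of
degree `r` in `r ^ 2` variables without non-trivial zero, so `r = 1`. Put `n = [L : k]`, and let `E`
be the ring of endomorphisms of `M` regarded as a module over `k`. Modulo its radical, `E` is a
product of matrix rings over fields. Each factor receives `L` together with units that induce all
automorphisms of `L`; they permute the eigenspaces of a primitive element of `L`, so `n` divides the
size of the matrices (`finrank_dvd_finrank_of_semilinear`). Lifting idempotents, `M` is over `k` the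
`n`-th power of a module `N` (`exists_completeOrthogonalIdempotents`, `exists_submodule_equiv_pi`),
and so is `L ⊗[k] N`. Finally, a Galois-invariant module over `L` is determined by its restriction
to `k`: the module `L →ₗ[k] M`, which depends on that restriction only, is the `n`-th power of `M`
over `L`, and roots of direct sums are unique by the Krull-Schmidt theorem (`exists_equiv_of_pi_equiv`).
Hence `M` and `L ⊗[k] N` are isomorphic over `L`.

For separable algebraic `K / F`, the extension of `X` to a separable closure `Ω` of `K`, which is
Galois over `F`, has a minimal field of definition. It is contained in every field of definition of
`X`, in particular in `K`, and by the theorem of Noether and Deuring `X` is defined over it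
(`exists_minimal_isDefinedOver`).
-/

noncomputable section

/-! ### Roots of direct sums -/

section KrullSchmidt

variable {B : Type*} [Ring B]

/-- Elimination of a summand: an isomorphism `X × U ≃ X × U'` whose component `X → X` is invertible
induces an isomorphism `U ≃ U'`. -/
theorem exists_equiv_of_isUnit_fst {X U U' : Type*} [AddCommGroup X] [Module B X]
    [AddCommGroup U] [Module B U] [AddCommGroup U'] [Module B U']
    (e : (X × U) ≃ₗ[B] (X × U'))
    (he : IsUnit (LinearMap.fst B X U' ∘ₗ e.toLinearMap ∘ₗ LinearMap.inl B X U : Module.End B X)) :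
    Nonempty (U ≃ₗ[B] U') := by
  obtain ⟨a, ha⟩ := he
  have ha' : ∀ x, (a : Module.End B X) x = (e (x, 0)).1 := fun x ↦ by rw [ha]; rfl
  have hinv : ∀ x, (a⁻¹ : (Module.End B X)ˣ).1 (a.1 x) = x := fun x ↦ by
    rw [← Module.End.mul_apply, Units.inv_mul, Module.End.one_apply]
  have hinv' : ∀ x, a.1 ((a⁻¹ : (Module.End B X)ˣ).1 x) = x := fun x ↦ by
    rw [← Module.End.mul_apply, Units.mul_inv, Module.End.one_apply]
  let s : U →ₗ[B] X := -((a⁻¹ : (Module.End B X)ˣ).1 ∘ₗ LinearMap.fst B X U' ∘ₗ e.toLinearMap ∘ₗ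
    LinearMap.inr B X U)
  have hs : ∀ u, s u = -((a⁻¹ : (Module.End B X)ˣ).1 (e (0, u)).1) := fun u ↦ rfl
  have hsplit : ∀ x u, e (x, u) = e (x, 0) + e (0, u) := fun x u ↦ by rw [← map_add]; simp
  let S : U →ₗ[B] U' := LinearMap.snd B X U' ∘ₗ e.toLinearMap ∘ₗ s.prod LinearMap.id
  let T : U' →ₗ[B] U := LinearMap.snd B X U ∘ₗ e.symm.toLinearMap ∘ₗ LinearMap.inr B X U'
  have hS : ∀ u, e (s u, u) = (0, S u) := fun u ↦ by
    refine Prod.ext ?_ rfl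
    rw [hsplit, Prod.fst_add, ← ha', hs, map_neg, hinv']
    simp
  have hT : ∀ u', ∃ x, e.symm (0, u') = (x, T u') := fun u' ↦ ⟨(e.symm (0, u')).1, rfl⟩
  refine ⟨LinearEquiv.ofLinearMap S T ?_ ?_⟩
  · ext u'
    obtain ⟨x, hx⟩ := hT u'
    have h1 : e (x, T u') = (0, u') := by rw [← hx, e.apply_symm_apply]
    have h2 : x = s (T u') := by
      have h3 := congrArg Prod.fst h1
      rw [hsplit, Prod.fst_add, ← ha'] at h3
      rw [hs, ← hinv x, ← map_neg]
      congr 1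
      exact eq_neg_of_add_eq_zero_left h3
    rw [h2, hS] at h1
    exact congrArg Prod.snd h1
  · ext u
    change (e.symm (0, S u)).2 = u
    rw [← hS, e.symm_apply_apply]

theorem Module.End.not_isUnit_of_isNilpotent {X : Type*} [AddCommGroup X] [Module B X]
    [Nontrivial X] {f : Module.End B X} (hf : IsNilpotent f) (g : Module.End B X) :
    ¬ IsUnit (g * f) := by
  intro h
  obtain ⟨n, hn⟩ := hf
  have hinj : Function.Injective f := by
    have := ((Module.End.isUnit_iff _).1 h).1
    exact Function.Injective.of_comp (f := g) this
  have : Function.Injective (f ^ n) := by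
    rw [Module.End.coe_pow]
    exact hinj.iterate n
  obtain ⟨x, hx⟩ := exists_ne (0 : X)
  exact hx (this (by simp [hn]))

/-- A nonzero module all of whose endomorphisms are invertible or nilpotent (so that its
endomorphism ring is local) can be cancelled from direct sums. -/
theorem exists_equiv_of_prod_equiv {X U U' : Type*} [AddCommGroup X] [Module B X] [Nontrivial X]
    [AddCommGroup U] [Module B U] [AddCommGroup U'] [Module B U']
    (hX : ∀ f : Module.End B X, IsUnit f ∨ IsNilpotent f)
    (e : (X × U) ≃ₗ[B] (X × U')) : Nonempty (U ≃ₗ[B] U') := by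
  let a : Module.End B X := LinearMap.fst B X U' ∘ₗ e.toLinearMap ∘ₗ LinearMap.inl B X U
  let a' : Module.End B X := LinearMap.fst B X U ∘ₗ e.symm.toLinearMap ∘ₗ LinearMap.inl B X U'
  let c : X →ₗ[B] U' := LinearMap.snd B X U' ∘ₗ e.toLinearMap ∘ₗ LinearMap.inl B X U
  let b' : U' →ₗ[B] X := LinearMap.fst B X U ∘ₗ e.symm.toLinearMap ∘ₗ LinearMap.inr B X U'
  have h1 : a' * a + b' ∘ₗ c = 1 := by
    ext x
    have : (e.symm ((e (x, 0)).1, 0)).1 + (e.symm (0, (e (x, 0)).2)).1 = x := by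
      rw [← Prod.fst_add, ← map_add]
      simp
    exact this
  by_cases ha : IsUnit a
  · exact exists_equiv_of_isUnit_fst e ha
  -- Otherwise `b' ∘ c` is invertible, and adding it to `a` by a shear makes the corner invertible.
  have hna : IsNilpotent a := (hX a).resolve_left ha
  have hbc : IsUnit (1 - a' * a) := by
    have := (hX (a' * a)).resolve_left (Module.End.not_isUnit_of_isNilpotent hna a')
    exact this.isUnit_one_sub
  let shear : (X × U') ≃ₗ[B] (X × U') :=
    LinearEquiv.ofLinearMap
      ((LinearMap.fst B X U' + b' ∘ₗ LinearMap.snd B X U').prod (LinearMap.snd B X U'))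
      ((LinearMap.fst B X U' - b' ∘ₗ LinearMap.snd B X U').prod (LinearMap.snd B X U'))
      (by ext <;> simp) (by ext <;> simp)
  refine exists_equiv_of_isUnit_fst (e.trans shear) ?_
  have h2 : (LinearMap.fst B X U' ∘ₗ (e.trans shear).toLinearMap ∘ₗ LinearMap.inl B X U :
      Module.End B X) = a + (1 - a' * a) := by
    rw [← h1, add_sub_cancel_left]
    rfl
  rw [h2]
  obtain ⟨v, hv⟩ := hbc
  rw [← hv]
  have h3 : a + v = v * (1 - (-(v⁻¹ : (Module.End B X)ˣ).1 * a)) := by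
    rw [mul_sub, neg_mul, mul_neg, ← mul_assoc, Units.mul_inv, one_mul, mul_one, sub_neg_eq_add,
      add_comm]
  rw [h3]
  refine v.isUnit.mul (IsNilpotent.isUnit_one_sub ?_)
  exact (hX _).resolve_left (Module.End.not_isUnit_of_isNilpotent hna _)

theorem exists_equiv_of_pi_prod_equiv {X U U' : Type*} [AddCommGroup X] [Module B X] [Nontrivial X]
    [AddCommGroup U] [Module B U] [AddCommGroup U'] [Module B U']
    (hX : ∀ f : Module.End B X, IsUnit f ∨ IsNilpotent f) (n : ℕ)
    (e : ((Fin n → X) × U) ≃ₗ[B] ((Fin n → X) × U')) : Nonempty (U ≃ₗ[B] U') := by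
  induction n with
  | zero =>
    exact ⟨(LinearEquiv.uniqueProd (R := B) (M₂ := Fin 0 → X) (M := U)).symm.trans
      (e.trans (LinearEquiv.uniqueProd (R := B) (M₂ := Fin 0 → X) (M := U')))⟩
  | succ n ih =>
    let c := Fin.consLinearEquiv B (fun _ : Fin (n + 1) ↦ X)
    let c' : ∀ (Z : Type _) [AddCommGroup Z] [Module B Z],
        (X × ((Fin n → X) × Z)) ≃ₗ[B] ((Fin (n + 1) → X) × Z) := fun Z _ _ ↦
      (LinearEquiv.prodAssoc B X (Fin n → X) Z).symm.trans
        (LinearEquiv.prodCongr c (LinearEquiv.refl B Z))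
    obtain ⟨e'⟩ := exists_equiv_of_prod_equiv hX ((c' U).trans (e.trans ((LinearEquiv.prodCongr c
      (LinearEquiv.refl B U')).symm.trans (LinearEquiv.prodAssoc B X (Fin n → X) U'))))
    exact ih e'

theorem isNilpotent_sum_of_isUnit_or_isNilpotent {X : Type*} [AddCommGroup X] [Module B X]
    [Nontrivial X] (hX : ∀ f : Module.End B X, IsUnit f ∨ IsNilpotent f) {J : Type*}
    (s : Finset J) (f : J → Module.End B X) (hf : ∀ j ∈ s, IsNilpotent (f j)) :
    IsNilpotent (∑ j ∈ s, f j) := by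
  classical
  induction s using Finset.induction_on with
  | empty => simp
  | insert j s hj ih =>
    rw [Finset.sum_insert hj]
    have h1 := hf j (Finset.mem_insert_self _ _)
    have h2 := ih fun i hi ↦ hf i (Finset.mem_insert_of_mem hi)
    refine (hX _).resolve_left ?_
    rintro ⟨u, hu⟩
    have h3 : (u⁻¹ : (Module.End B X)ˣ).1 * f j =
        1 - (u⁻¹ : (Module.End B X)ˣ).1 * ∑ i ∈ s, f i := by
      rw [eq_sub_iff_add_eq, ← mul_add, ← hu, Units.inv_mul]
    refine Module.End.not_isUnit_of_isNilpotent h1 (u⁻¹ : (Module.End B X)ˣ).1 ?_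
    rw [h3]
    refine IsNilpotent.isUnit_one_sub ?_
    exact (hX _).resolve_left (Module.End.not_isUnit_of_isNilpotent h2 _)

/-- A nonzero module of finite length has a nonzero direct summand all of whose endomorphisms are
invertible or nilpotent: by Fitting's lemma, a minimal nonzero direct summand will do. -/
theorem exists_isCompl_isUnit_or_isNilpotent (V : Type*) [AddCommGroup V] [Module B V]
    [IsArtinian B V] [IsNoetherian B V] [Nontrivial V] :
    ∃ X Y : Submodule B V, IsCompl X Y ∧ X ≠ ⊥ ∧
      ∀ f : Module.End B X, IsUnit f ∨ IsNilpotent f := by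
  obtain ⟨X, ⟨hX, Y, hXY⟩, hmin⟩ := WellFounded.has_min
    (wellFounded_lt (α := Submodule B V)) {X | X ≠ ⊥ ∧ ∃ Y, IsCompl X Y}
    ⟨⊤, top_ne_bot, ⊥, isCompl_top_bot⟩
  refine ⟨X, Y, hXY, hX, fun f ↦ ?_⟩
  obtain ⟨n, hn, hn1⟩ := ((LinearMap.eventually_isCompl_ker_pow_range_pow f).and
    (Filter.eventually_ge_atTop 1)).exists
  set P := LinearMap.ker (f ^ n) with hP
  set R := LinearMap.range (f ^ n) with hR
  have hinj : Function.Injective X.subtype := X.injective_subtype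
  have hsup : P.map X.subtype ⊔ R.map X.subtype = X := by
    rw [← Submodule.map_sup, hn.sup_eq_top, Submodule.map_top, Submodule.range_subtype]
  have hdis : Disjoint (P.map X.subtype) (R.map X.subtype) :=
    (Submodule.disjoint_map hinj hn.disjoint)
  have hcompl : IsCompl (P.map X.subtype) (R.map X.subtype ⊔ Y) := by
    refine ⟨hdis.disjoint_sup_right_of_disjoint_sup_left (by rw [hsup]; exact hXY.disjoint), ?_⟩
    rw [codisjoint_iff, ← sup_assoc, hsup, hXY.sup_eq_top]
  by_cases hbot : P = ⊥
  · left
    have hR' : R = ⊤ := by simpa [hbot] using hn.sup_eq_top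
    have : IsUnit (f ^ n) := (Module.End.isUnit_iff _).2
      ⟨LinearMap.ker_eq_bot.1 hbot, LinearMap.range_eq_top.1 hR'⟩
    exact (isUnit_pow_iff (by lia)).1 this
  · right
    refine ⟨n, LinearMap.ker_eq_top.1 ?_⟩
    have h1 : P.map X.subtype ≠ ⊥ := by
      rw [Ne, ← Submodule.map_bot X.subtype, (Submodule.map_injective_of_injective hinj).eq_iff]
      exact hbot
    have h2 : P.map X.subtype ≤ X := Submodule.map_subtype_le _ _
    have h3 : P.map X.subtype = X := by
      by_contra h
      exact hmin _ ⟨h1, _, hcompl⟩ (lt_of_le_of_ne h2 h)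
    refine Submodule.map_injective_of_injective hinj ?_
    rw [← hP, h3, Submodule.map_top, Submodule.range_subtype]

/-- A split monomorphism exhibits its source as a direct factor. -/
def LinearMap.equivProdKerOfComp {X W : Type*} [AddCommGroup X] [Module B X] [AddCommGroup W]
    [Module B W] (i : X →ₗ[B] W) (p : W →ₗ[B] X) (h : ∀ x, p (i x) = x) :
    W ≃ₗ[B] (X × LinearMap.ker p) where
  toFun w := (p w, ⟨w - i (p w), by simp [h]⟩)
  map_add' v w := by
    ext <;> simp
    abel
  map_smul' r w := by ext <;> simp [smul_sub]
  invFun z := i z.1 + z.2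
  left_inv w := by simp
  right_inv z := by
    have := z.2.2
    rw [LinearMap.mem_ker] at this
    ext <;> simp [h, this]

/-- The equivalence `(J → X × Y) ≃ (J → X) × (J → Y)`. -/
def piProdLinearEquiv (J X Y : Type*) [AddCommGroup X] [Module B X] [AddCommGroup Y]
    [Module B Y] : (J → X × Y) ≃ₗ[B] ((J → X) × (J → Y)) where
  toFun f := (fun j ↦ (f j).1, fun j ↦ (f j).2)
  map_add' _ _ := rfl
  map_smul' _ _ := rfl
  invFun f j := (f.1 j, f.2 j)
  left_inv _ := rfl
  right_inv _ := rfl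

/-- Induction on the length: a summand `X` of `V` with local endomorphism ring is also a summand of
`W`, and is cancelled from both sides. -/
theorem exists_equiv_of_pi_equiv_aux {n : ℕ} (hn : 0 < n) (N : ℕ) :
    ∀ (V : Type*) (W : Type*) [AddCommGroup V] [Module B V] [AddCommGroup W] [Module B W]
      [IsArtinian B V] [IsNoetherian B V], Module.length B V ≤ N →
      ((Fin n → V) ≃ₗ[B] (Fin n → W)) → Nonempty (V ≃ₗ[B] W) := by
  induction N with
  | zero =>
    intro V W _ _ _ _ _ _ hV e
    have : Subsingleton V := Module.length_eq_zero_iff.1 (by simpa using hV)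
    have : Subsingleton (Fin n → W) := e.symm.toEquiv.subsingleton
    have : Subsingleton W := by
      have : Nonempty (Fin n) := ⟨⟨0, hn⟩⟩
      exact (Function.surjective_eval (β := fun _ : Fin n ↦ W) ⟨0, hn⟩).subsingleton
    exact ⟨LinearEquiv.ofSubsingleton V W⟩
  | succ N ih =>
    intro V W _ _ _ _ _ _ hV e
    rcases subsingleton_or_nontrivial V with hs | hs
    · have : Subsingleton (Fin n → W) := e.symm.toEquiv.subsingleton
      have : Subsingleton W := by
        have : Nonempty (Fin n) := ⟨⟨0, hn⟩⟩
        exact (Function.surjective_eval (β := fun _ : Fin n ↦ W) ⟨0, hn⟩).subsingleton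
      exact ⟨LinearEquiv.ofSubsingleton V W⟩
    obtain ⟨X, Y, hXY, hX, hloc⟩ := exists_isCompl_isUnit_or_isNilpotent (B := B) V
    have : Nontrivial X := Submodule.nontrivial_iff_ne_bot.2 hX
    let eV : (X × Y) ≃ₗ[B] V := Submodule.prodEquivOfIsCompl X Y hXY
    let i : X →ₗ[B] (Fin n → V) := LinearMap.single B (fun _ ↦ V) ⟨0, hn⟩ ∘ₗ X.subtype
    let p : (Fin n → V) →ₗ[B] X := LinearMap.fst B X Y ∘ₗ eV.symm.toLinearMap ∘ₗ
      LinearMap.proj ⟨0, hn⟩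
    have hpi : ∀ x, p (i x) = x := fun x ↦ by
      have : eV.symm (x : V) = (x, 0) := by
        rw [LinearEquiv.symm_apply_eq]
        simp [eV]
      simp [p, i, this]
    let q : Fin n → X →ₗ[B] W := fun s ↦ LinearMap.proj s ∘ₗ e.toLinearMap ∘ₗ i
    let r : Fin n → W →ₗ[B] X := fun s ↦ p ∘ₗ e.symm.toLinearMap ∘ₗ LinearMap.single B (fun _ ↦ W) s
    have hsum : ∑ s, (r s ∘ₗ q s : Module.End B X) = 1 := by
      ext x
      have h1 : ∑ s, LinearMap.single B (fun _ : Fin n ↦ W) s (e (i x) s) = e (i x) := by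
        simp [LinearMap.single_apply, Finset.univ_sum_single]
      have h2 : ∑ s, (r s ∘ₗ q s) x = p (e.symm (∑ s, LinearMap.single B (fun _ : Fin n ↦ W) s
          (e (i x) s))) := by
        rw [map_sum, map_sum]
        rfl
      rw [LinearMap.sum_apply, h2, h1, e.symm_apply_apply, hpi, Module.End.one_apply]
    -- Nilpotent endomorphisms of `X` cannot sum to the identity.
    obtain ⟨s, hs⟩ : ∃ s, IsUnit (r s ∘ₗ q s : Module.End B X) := by
      by_contra! hcon
      have h1 := isNilpotent_sum_of_isUnit_or_isNilpotent hloc Finset.univ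
        (fun s ↦ (r s ∘ₗ q s : Module.End B X)) fun s _ ↦ (hloc _).resolve_left (hcon s)
      rw [hsum] at h1
      exact not_isNilpotent_one h1
    obtain ⟨u, hu⟩ := hs
    let p' : W →ₗ[B] X := (u⁻¹ : (Module.End B X)ˣ).1 ∘ₗ r s
    have hp' : ∀ x, p' (q s x) = x := fun x ↦ by
      change (u⁻¹ : (Module.End B X)ˣ).1 ((r s ∘ₗ q s : Module.End B X) x) = x
      rw [← hu, ← Module.End.mul_apply, Units.inv_mul, Module.End.one_apply]
    let eW := LinearMap.equivProdKerOfComp (q s) p' hp'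
    obtain ⟨e'⟩ := exists_equiv_of_pi_prod_equiv hloc n
      ((piProdLinearEquiv (B := B) (Fin n) X Y).symm.trans
        ((LinearEquiv.piCongrRight fun _ ↦ eV).trans
          (e.trans ((LinearEquiv.piCongrRight fun _ ↦ eW).trans
            (piProdLinearEquiv (B := B) (Fin n) X (LinearMap.ker p'))))))
    have hlen : Module.length B Y ≤ N := by
      have h1 : Module.length B X + Module.length B Y = Module.length B V := by
        rw [← Module.length_prod, eV.length_eq]
      have h2 : 1 ≤ Module.length B X := Order.one_le_iff_pos.2 Module.length_pos
      have h3 : Module.length B Y + 1 ≤ N + 1 := by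
        refine le_trans ?_ (hV.trans_eq (by norm_cast))
        rw [← h1, add_comm]
        exact add_le_add_left h2 _
      exact (ENat.add_le_add_iff_right (by simp)).1 h3
    obtain ⟨e''⟩ := ih Y (LinearMap.ker p') hlen e'
    exact ⟨eV.symm.trans ((LinearEquiv.prodCongr (LinearEquiv.refl B X) e'').trans eW.symm)⟩

/-- Roots of direct sums are unique: modules of finite length with isomorphic `n`-th powers are
isomorphic. -/
theorem exists_equiv_of_pi_equiv {J : Type*} [Finite J] [Nonempty J] {V W : Type*}
    [AddCommGroup V] [Module B V] [AddCommGroup W] [Module B W] [IsArtinian B V] [IsNoetherian B V]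
    (e : (J → V) ≃ₗ[B] (J → W)) : Nonempty (V ≃ₗ[B] W) := by
  obtain ⟨n, ⟨f⟩⟩ := Finite.exists_equiv_fin J
  have hn : 0 < n := Fin.pos_iff_nonempty.2 (f.symm.nonempty)
  obtain ⟨N, hN⟩ := ENat.ne_top_iff_exists.1 (Module.length_ne_top (R := B) (M := V))
  exact exists_equiv_of_pi_equiv_aux hn N V W hN.ge
    ((LinearEquiv.funCongrLeft B V f).trans (e.trans (LinearEquiv.funCongrLeft B W f.symm)))

end KrullSchmidt

/-- Operator form of `exists_equiv_of_pi_equiv`: the modules are finite-dimensional vector spaces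
with a family of endomorphisms. -/
theorem exists_equiv_of_pi_equiv_of_commute {k ι J V W : Type*} [Field k] [Finite J] [Nonempty J]
    [AddCommGroup V] [Module k V] [FiniteDimensional k V] [AddCommGroup W] [Module k W]
    (x : ι → Module.End k V) (y : ι → Module.End k W) (e : (J → V) ≃ₗ[k] (J → W))
    (he : ∀ i v, e (fun j ↦ x i (v j)) = fun j ↦ y i (e v j)) :
    ∃ f : V ≃ₗ[k] W, ∀ i v, f (x i v) = y i (f v) := by
  let ρ := FreeAlgebra.lift k x
  let σ := FreeAlgebra.lift k y
  let _ : Module (FreeAlgebra k ι) V := Module.compHom V ρ.toRingHom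
  let _ : Module (FreeAlgebra k ι) W := Module.compHom W σ.toRingHom
  have hV : ∀ (b : FreeAlgebra k ι) (v : V), b • v = ρ b v := fun _ _ ↦ rfl
  have hW : ∀ (b : FreeAlgebra k ι) (w : W), b • w = σ b w := fun _ _ ↦ rfl
  have : IsScalarTower k (FreeAlgebra k ι) V := ⟨fun c b v ↦ by simp [hV]⟩
  have hall : ∀ (b : FreeAlgebra k ι) (v : J → V), e (fun j ↦ ρ b (v j)) = fun j ↦ σ b (e v j) := by
    intro b
    induction b using FreeAlgebra.induction with
    | grade0 c =>
      intro v
      simp only [AlgHom.commutes, Module.algebraMap_end_apply]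
      exact e.map_smul c v
    | grade1 i => simpa [ρ, σ] using he i
    | mul a b ha hb =>
      intro v
      simp only [map_mul, Module.End.mul_apply]
      rw [ha, hb]
    | add a b ha hb =>
      intro v
      simp only [map_add, LinearMap.add_apply]
      have := e.map_add (fun j ↦ ρ a (v j)) (fun j ↦ ρ b (v j))
      rw [ha, hb] at this
      exact this
  have : IsArtinian (FreeAlgebra k ι) V := isArtinian_of_tower k inferInstance
  have : IsNoetherian (FreeAlgebra k ι) V := isNoetherian_of_tower k inferInstance
  obtain ⟨f⟩ := exists_equiv_of_pi_equiv (B := FreeAlgebra k ι) (J := J) (V := V) (W := W)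
    { e with map_smul' := fun b v ↦ hall b v }
  refine ⟨{ f with map_smul' := fun c v ↦ ?_ }, fun i v ↦ ?_⟩
  · have := f.map_smul (algebraMap k _ c) v
    simpa [hV, hW, Module.algebraMap_end_apply] using! this
  · have := f.map_smul (FreeAlgebra.ι k i) v
    simpa [hV, hW, ρ, σ] using! this

/-! ### Division algebras over `C₁`-fields -/

section C1

theorem IsC1Field.exists_eval_eq_zero {F : Type*} [Field F] (hF : IsC1Field F) {σ : Type*}
    [Fintype σ] {d : ℕ} (f : MvPolynomial σ F) (hd : 0 < d) (hdσ : d < Fintype.card σ)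
    (hf : f.IsHomogeneous d) : ∃ x : σ → F, x ≠ 0 ∧ MvPolynomial.eval x f = 0 := by
  let e := Fintype.equivFin σ
  obtain ⟨x, hx, hx0⟩ := hF _ d (MvPolynomial.rename e f) hd hdσ hf.rename_isHomogeneous
  refine ⟨x ∘ e, fun h ↦ hx ?_, by rwa [MvPolynomial.eval_rename] at hx0⟩
  ext i
  simpa using congrFun h (e.symm i)

theorem Matrix.det_isHomogeneous {σ n R : Type*} [CommRing R] [Fintype n] [DecidableEq n]
    (A : Matrix n n (MvPolynomial σ R)) {d : ℕ} (hA : ∀ i j, (A i j).IsHomogeneous d) :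
    A.det.IsHomogeneous (d * Fintype.card n) := by
  rw [Matrix.det_apply]
  refine MvPolynomial.IsHomogeneous.sum _ _ _ fun τ _ ↦ ?_
  have h : (∏ i, A (τ i) i).IsHomogeneous (d * Fintype.card n) := by
    have := MvPolynomial.IsHomogeneous.prod Finset.univ (fun i ↦ A (τ i) i) (fun _ ↦ d)
      fun i _ ↦ hA _ _
    simpa [mul_comm] using this
  rcases Int.units_eq_one_or (Equiv.Perm.sign τ) with h1 | h1
  · simpa [h1] using h
  · rw [h1, Units.neg_smul, one_smul]
    exact (MvPolynomial.homogeneousSubmodule σ R _).neg_mem h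

theorem MvPolynomial.eval_aeval {R σ τ : Type*} [CommSemiring R] (x : τ → R)
    (h : σ → MvPolynomial τ R) (f : MvPolynomial σ R) :
    eval x (aeval h f) = eval (fun i ↦ eval x (h i)) f := by
  induction f using MvPolynomial.induction_on with
  | C r => simp
  | add p q hp hq => rw [map_add, map_add, hp, hq, map_add]
  | mul_X p i hp => rw [map_mul, map_mul, hp, map_mul, aeval_X, eval_X]

/-- A finite extension of a `C₁`-field is a `C₁`-field: compose a form over the extension with the
norm form. -/
theorem IsC1Field.of_finiteDimensional {F E : Type*} [Field F] [Field E] [Algebra F E]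
    [FiniteDimensional F E] (hF : IsC1Field F) : IsC1Field E := by
  intro n d f hd hdn hf
  let l := Module.finrank F E
  let b : Module.Basis (Fin l) F E := Module.finBasis F E
  have hl : 0 < l := Module.finrank_pos
  let g : MvPolynomial (Fin n × Fin l) E :=
    MvPolynomial.aeval (fun i ↦ ∑ j, MvPolynomial.C (b j) * MvPolynomial.X (i, j)) f
  have hg : g.IsHomogeneous d := by
    have := hf.aeval (fun i ↦ ∑ j, (MvPolynomial.C (b j) * MvPolynomial.X (i, j) :
      MvPolynomial (Fin n × Fin l) E)) (n := 1) fun i ↦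
        MvPolynomial.IsHomogeneous.sum _ _ _ fun j _ ↦ by
          simpa using (MvPolynomial.isHomogeneous_C _ (b j)).mul
            (MvPolynomial.isHomogeneous_X E (i, j))
    rwa [one_mul] at this
  have hgeval : ∀ y : Fin n × Fin l → F, MvPolynomial.eval (fun p ↦ algebraMap F E (y p)) g =
      MvPolynomial.eval (fun i ↦ ∑ j, y (i, j) • b j) f := fun y ↦ by
    rw [MvPolynomial.eval_aeval]
    refine congrArg (fun z ↦ MvPolynomial.eval z f) (funext fun i ↦ ?_)
    simp only [map_sum, map_mul, MvPolynomial.eval_C, MvPolynomial.eval_X, Algebra.smul_def]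
    exact Finset.sum_congr rfl fun j _ ↦ mul_comm _ _
  -- The coordinates of the form `g` with respect to the basis `b`.
  let c : Fin l → MvPolynomial (Fin n × Fin l) F := fun j ↦
    ∑ s ∈ g.support, MvPolynomial.monomial s (b.repr (g.coeff s) j)
  have hc : ∀ j, (c j).IsHomogeneous d := fun j ↦
    MvPolynomial.IsHomogeneous.sum _ _ _ fun s hs ↦ MvPolynomial.isHomogeneous_monomial _ <| by
      rw [Finsupp.degree_eq_weight_one]
      exact hg (MvPolynomial.mem_support_iff.1 hs)
  have hceval : ∀ (y : Fin n × Fin l → F), ∑ j, MvPolynomial.eval y (c j) • b j =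
      MvPolynomial.eval (fun p ↦ algebraMap F E (y p)) g := fun y ↦ by
    have h1 : ∀ j, MvPolynomial.eval y (c j) =
        b.repr (MvPolynomial.eval (fun p ↦ algebraMap F E (y p)) g) j := fun j ↦ by
      rw [MvPolynomial.eval_eq' _ g, map_sum, map_sum, Finsupp.finsetSum_apply]
      refine Finset.sum_congr rfl fun s _ ↦ ?_
      have : MvPolynomial.coeff s g * ∏ i, algebraMap F E (y i) ^ s i =
          (∏ i, y i ^ s i) • MvPolynomial.coeff s g := by
        rw [Algebra.smul_def, map_prod, mul_comm]
        simp
      rw [this, map_smul, MvPolynomial.eval_monomial, Finsupp.smul_apply, smul_eq_mul, mul_comm,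
        Finsupp.prod_fintype _ _ (by simp)]
    simp_rw [h1]
    exact b.sum_repr _
  -- The determinant of `A` is the norm of `g`, a form of degree `d * l` in `n * l` variables.
  let A : Matrix (Fin l) (Fin l) (MvPolynomial (Fin n × Fin l) F) :=
    ∑ j, c j • (Algebra.leftMulMatrix b (b j)).map MvPolynomial.C
  have hA : A.det.IsHomogeneous (d * Fintype.card (Fin l)) :=
    Matrix.det_isHomogeneous A fun s t ↦ by
      simp only [A, Matrix.sum_apply, Matrix.smul_apply, Matrix.map_apply, smul_eq_mul]
      refine MvPolynomial.IsHomogeneous.sum _ _ _ fun j _ ↦ ?_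
      simpa using (hc j).mul (MvPolynomial.isHomogeneous_C (Fin n × Fin l)
        (Algebra.leftMulMatrix b (b j) s t))
  obtain ⟨y, hy, hy0⟩ := hF.exists_eval_eq_zero A.det (by simpa using ⟨hd, hl⟩)
    (by simpa using Nat.mul_lt_mul_of_pos_right hdn hl) hA
  refine ⟨fun i ↦ ∑ j, y (i, j) • b j, fun h ↦ hy ?_, ?_⟩
  · ext ⟨i, j⟩
    exact Fintype.linearIndependent_iff.1 b.linearIndependent _ (congrFun h i) j
  · rw [← hgeval, ← hceval, ← Algebra.norm_eq_zero_iff (R := F) , Algebra.norm_eq_matrix_det b,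
      ← hy0, RingHom.map_det]
    congr 1
    ext s t
    simp [A, Matrix.sum_apply]

end C1

section SimpleTensor

variable {Z D Ω : Type*} [Field Z] [DivisionRing D] [Algebra Z D] [Field Ω] [Algebra Z Ω]

/-- In the left `D`-basis `1 ⊗ β j` of `D ⊗ Ω`, left multiplication by `D` acts on coordinates. -/
theorem basis_repr_tmul_one_mul {κ : Type*} (β : Module.Basis κ Z Ω) (d : D) (y : D ⊗[Z] Ω)
    (j : κ) : (Algebra.TensorProduct.basis D β).repr (d ⊗ₜ 1 * y) j =
      d * (Algebra.TensorProduct.basis D β).repr y j := by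
  have : (d ⊗ₜ[Z] (1 : Ω)) * y = d • y := by
    induction y with
    | zero => simp
    | add a b ha hb => rw [mul_add, ha, hb, smul_add]
    | tmul a b => rw [Algebra.TensorProduct.tmul_mul_tmul, one_mul, TensorProduct.smul_tmul',
        smul_eq_mul]
  rw [this, map_smul, Finsupp.smul_apply, smul_eq_mul]

/-- Since the basis elements `1 ⊗ β j` commute with `D`, right multiplication by `D` acts on
coordinates as well. -/
theorem basis_repr_mul_tmul_one {κ : Type*} (β : Module.Basis κ Z Ω) (d : D) (y : D ⊗[Z] Ω)
    (j : κ) : (Algebra.TensorProduct.basis D β).repr (y * d ⊗ₜ 1) j =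
      (Algebra.TensorProduct.basis D β).repr y j * d := by
  induction y with
  | zero => simp
  | add a b ha hb => rw [add_mul, map_add, map_add, Finsupp.add_apply, Finsupp.add_apply, ha, hb,
      add_mul]
  | tmul a b =>
    simp only [Algebra.TensorProduct.tmul_mul_tmul, mul_one, Algebra.TensorProduct.basis_repr_tmul,
      Finsupp.smul_apply, Finsupp.mapRange_apply, smul_eq_mul, mul_assoc, Algebra.commutes]

/-- An element of `D ⊗ Ω` commuting with the central algebra `D` lies in `Ω`. -/
theorem exists_eq_one_tmul_of_commute [Algebra.IsCentral Z D] (x : D ⊗[Z] Ω)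
    (hx : ∀ d : D, d ⊗ₜ 1 * x = x * d ⊗ₜ 1) : ∃ ω : Ω, x = 1 ⊗ₜ ω := by
  let β := Module.Basis.ofVectorSpace Z Ω
  let c := Algebra.TensorProduct.basis D β
  have hcen : ∀ j, ∃ z : Z, c.repr x j = algebraMap Z D z := fun j ↦ by
    refine (Algebra.IsCentral.mem_center_iff Z).1 (Subalgebra.mem_center_iff.2 fun d ↦ ?_)
    rw [← basis_repr_tmul_one_mul, ← basis_repr_mul_tmul_one, hx]
  choose z hz using hcen
  refine ⟨∑ j ∈ (c.repr x).support, z j • β j, ?_⟩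
  conv_lhs => rw [← c.linearCombination_repr x]
  rw [Finsupp.linearCombination_apply, Finsupp.sum, TensorProduct.tmul_sum]
  refine Finset.sum_congr rfl fun j _ ↦ ?_
  rw [hz, Algebra.TensorProduct.basis_apply, TensorProduct.tmul_smul, algebraMap_smul]

/-- The scalar extension of a central division algebra is simple. -/
theorem isSimpleRing_tensorProduct [Algebra.IsCentral Z D] : IsSimpleRing (D ⊗[Z] Ω) := by
  classical
  let β := Module.Basis.ofVectorSpace Z Ω
  let c := Algebra.TensorProduct.basis D β
  have hnt : Nontrivial (D ⊗[Z] Ω) := inferInstance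
  refine (IsSimpleRing.iff_injective_ringHom _).2 fun {S} _ _ f ↦ ?_
  rw [injective_iff_map_eq_zero]
  by_contra! hcon
  -- A nonzero element of the kernel with as few nonzero coordinates as possible.
  obtain ⟨x, ⟨hfx, hx⟩, hmin⟩ := WellFounded.has_min
    (measure fun x : D ⊗[Z] Ω ↦ (c.repr x).support.card).wf {x | f x = 0 ∧ x ≠ 0} hcon
  obtain ⟨j, hj⟩ : ∃ j, c.repr x j ≠ 0 := by
    by_contra! h
    exact hx (c.ext_elem fun j ↦ by rw [h j, map_zero, Finsupp.zero_apply])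
  let y := ((c.repr x j)⁻¹ ⊗ₜ[Z] (1 : Ω)) * x
  have hy : ∀ i, c.repr y i = (c.repr x j)⁻¹ * c.repr x i := fun i ↦
    basis_repr_tmul_one_mul β _ x i
  have hyj : c.repr y j = 1 := by rw [hy, inv_mul_cancel₀ hj]
  have hfy : f y = 0 := by rw [map_mul, hfx, mul_zero]
  obtain ⟨ω, hω⟩ := exists_eq_one_tmul_of_commute y fun d ↦ by
    -- The commutator of `y` with `d` lies in the kernel and has no `j`-th coordinate.
    by_contra hne
    have hne' : d ⊗ₜ 1 * y - y * d ⊗ₜ 1 ≠ 0 := sub_ne_zero.2 hne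
    have hker : f (d ⊗ₜ 1 * y - y * d ⊗ₜ 1) = 0 := by
      have h := map_add f (d ⊗ₜ 1 * y - y * d ⊗ₜ 1) (y * d ⊗ₜ 1)
      rw [sub_add_cancel, map_mul, map_mul f y, hfy, mul_zero, zero_mul, add_zero] at h
      exact h.symm
    refine hmin (d ⊗ₜ 1 * y - y * d ⊗ₜ 1) ⟨hker, hne'⟩ (Finset.card_lt_card ?_)
    have hcoord : ∀ i, c.repr (d ⊗ₜ 1 * y - y * d ⊗ₜ 1) i = d * c.repr y i - c.repr y i * d :=
      fun i ↦ by
        rw [map_sub, Finsupp.sub_apply]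
        exact congrArg₂ _ (basis_repr_tmul_one_mul β _ _ _) (basis_repr_mul_tmul_one β _ _ _)
    refine (Finset.ssubset_iff_of_subset fun i hi ↦ ?_).2 ⟨j, by simpa using hj, ?_⟩
    · rw [Finsupp.mem_support_iff, hcoord, hy] at hi
      rw [Finsupp.mem_support_iff]
      intro h
      simp [h] at hi
    · rw [Finsupp.mem_support_iff, hcoord, hyj]
      simp
  have hω0 : ω ≠ 0 := by
    rintro rfl
    rw [hω, TensorProduct.tmul_zero, map_zero] at hyj
    exact zero_ne_one hyj
  have h1 : y * (1 ⊗ₜ ω⁻¹) = 1 := by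
    rw [hω, Algebra.TensorProduct.tmul_mul_tmul, mul_one, mul_inv_cancel₀ hω0]
    rfl
  have h2 := congrArg f h1
  rw [map_mul, hfy, zero_mul, map_one] at h2
  exact zero_ne_one h2

end SimpleTensor

section DivisionAlgebra

/-- A central division algebra over a separably closed field is trivial, by the theorem of Jacobson
and Noether. -/
theorem IsSepClosed.bot_eq_top_of_isCentral {Ω D : Type*} [Field Ω] [IsSepClosed Ω]
    [DivisionRing D] [Algebra Ω D] [FiniteDimensional Ω D] [Algebra.IsCentral Ω D] :
    (⊥ : Subalgebra Ω D) = ⊤ := by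
  by_contra hne
  obtain ⟨x, hx, hsep⟩ := JacobsonNoether.exists_separable_and_not_isCentral' hne
  refine hx (Algebra.mem_bot.2 (minpoly.mem_range_of_degree_eq_one Ω x ?_))
  exact IsSepClosed.degree_eq_one_of_irreducible Ω
    (minpoly.irreducible (Algebra.IsIntegral.isIntegral x)) hsep

/-- A separably closed field splits central division algebras. -/
theorem exists_algEquiv_matrix_of_isSepClosed (Z D Ω : Type*) [Field Z] [DivisionRing D]
    [Algebra Z D] [FiniteDimensional Z D] [Algebra.IsCentral Z D] [Field Ω] [Algebra Z Ω]
    [IsSepClosed Ω] :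
    ∃ (r : ℕ), 0 < r ∧ Nonempty (Ω ⊗[Z] D ≃ₐ[Ω] Matrix (Fin r) (Fin r) Ω) := by
  have hsimple : IsSimpleRing (Ω ⊗[Z] D) :=
    IsSimpleRing.of_ringEquiv (Algebra.TensorProduct.comm Z D Ω).toRingEquiv
      isSimpleRing_tensorProduct
  have hart : IsArtinianRing (Ω ⊗[Z] D) := isArtinian_of_tower Ω inferInstance
  obtain ⟨r, hr, D', _, _, _, ⟨e⟩⟩ :=
    IsSimpleRing.exists_algEquiv_matrix_divisionRing_finite Ω (Ω ⊗[Z] D)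
  -- A central element of `D'` gives a scalar matrix in the centre of `Ω ⊗ D`, which is `Ω`.
  have hcentral : Algebra.IsCentral Ω D' := ⟨fun z hz ↦ by
    have hz' : ∀ d, d * z = z * d := Subalgebra.mem_center_iff.1 hz
    let y : Ω ⊗[Z] D := e.symm (Matrix.scalar (Fin r) z)
    have hcomm : ∀ w, w * y = y * w := fun w ↦ e.injective <| by
      rw [map_mul, map_mul, e.apply_symm_apply]
      exact (Matrix.scalar_commute z (fun d ↦ (hz' d).symm) (e w)).eq.symm
    obtain ⟨ω, hω⟩ := exists_eq_one_tmul_of_commute (Algebra.TensorProduct.comm Z Ω D y) fun d ↦ by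
      have := congrArg (Algebra.TensorProduct.comm Z Ω D) (hcomm (1 ⊗ₜ d))
      simpa using this
    have h1 : y = algebraMap Ω _ ω := by
      apply (Algebra.TensorProduct.comm Z Ω D).injective
      rw [hω]
      simp [Algebra.TensorProduct.algebraMap_apply]
    have h2 : Matrix.scalar (Fin r) z = algebraMap Ω _ ω := by
      rw [← e.apply_symm_apply (Matrix.scalar (Fin r) z)]
      change e y = _
      rw [h1, AlgEquiv.commutes]
    have h3 := congrFun (congrFun h2 0) 0
    refine Algebra.mem_bot.2 ⟨ω, ?_⟩
    simpa [Matrix.algebraMap_matrix_apply] using h3.symm⟩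
  have hbij : Function.Bijective (Algebra.ofId Ω D') :=
    ⟨(algebraMap Ω D').injective, fun x ↦ by
      have : x ∈ (⊥ : Subalgebra Ω D') := by
        rw [IsSepClosed.bot_eq_top_of_isCentral]
        trivial
      exact Algebra.mem_bot.1 this⟩
  exact ⟨r, Nat.pos_of_ne_zero hr.ne, ⟨e.trans (AlgEquiv.ofBijective _ hbij).symm.mapMatrix⟩⟩

/-- Automorphisms of a matrix algebra are inner. -/
theorem Matrix.exists_units_conj {K n : Type*} [Field K] [Fintype n] [DecidableEq n]
    (θ : Matrix n n K ≃ₐ[K] Matrix n n K) :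
    ∃ U : (Matrix n n K)ˣ, ∀ A, θ A * U = U * A := by
  let t : Matrix n n K ≃ₐ[K] Module.End K (n → K) := Matrix.toLinAlgEquiv'
  obtain ⟨T, hT⟩ := AlgEquiv.eq_linearEquivConjAlgEquiv ((t.symm.trans θ).trans t)
  have h1 : t.symm T.toLinearMap * t.symm T.symm.toLinearMap = 1 := by
    rw [← map_mul, ← map_one t.symm]
    congr 1
    exact LinearMap.ext fun v ↦ by simp
  refine ⟨⟨t.symm T.toLinearMap, t.symm T.symm.toLinearMap, h1, mul_eq_one_comm.1 h1⟩, fun A ↦ ?_⟩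
  apply t.injective
  have h2 : t (θ A) = T.conjAlgEquiv K (t A) := by
    rw [← hT]
    simp
  rw [map_mul, map_mul, h2]
  exact LinearMap.ext fun v ↦ by simp

/-- Matrix representations of a central division algebra that are conjugate under the Galois group
are equivalent. -/
theorem exists_units_map_mul_eq {Z D Ω : Type*} [Field Z] [DivisionRing D]
    [Algebra Z D] [Algebra.IsCentral Z D] [Field Ω] [Algebra Z Ω] {r : ℕ}
    [Nonempty (Fin r)] (e : Ω ⊗[Z] D ≃ₐ[Ω] Matrix (Fin r) (Fin r) Ω) (σ : Gal(Ω/Z)) :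
    ∃ U : (Matrix (Fin r) (Fin r) Ω)ˣ,
      ∀ d, (e (1 ⊗ₜ d)).map σ * (U : Matrix (Fin r) (Fin r) Ω) = U * e (1 ⊗ₜ d) := by
  have : IsSimpleRing (Ω ⊗[Z] D) :=
    IsSimpleRing.of_ringEquiv (Algebra.TensorProduct.comm Z D Ω).toRingEquiv
      isSimpleRing_tensorProduct
  let ψσ : D →ₐ[Z] Matrix (Fin r) (Fin r) Ω := (σ.mapMatrix : Matrix (Fin r) (Fin r) Ω ≃ₐ[Z]
    Matrix (Fin r) (Fin r) Ω).toAlgHom.comp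
      ((e.toAlgHom.restrictScalars Z).comp Algebra.TensorProduct.includeRight)
  have hψσ : ∀ d, ψσ d = (e (1 ⊗ₜ d)).map σ := fun _ ↦ rfl
  let eσ : Ω ⊗[Z] D →ₐ[Ω] Matrix (Fin r) (Fin r) Ω :=
    Algebra.TensorProduct.lift (Algebra.ofId Ω _) ψσ fun ω _ ↦ Algebra.commutes ω _
  have hinj : Function.Injective eσ := eσ.toRingHom.injective
  have hfin : FiniteDimensional Ω (Ω ⊗[Z] D) := Module.Finite.equiv e.toLinearEquiv.symm
  have hbij : Function.Bijective eσ := ⟨hinj,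
    (LinearMap.injective_iff_surjective_of_finrank_eq_finrank (f := eσ.toLinearMap)
      e.toLinearEquiv.finrank_eq).1 hinj⟩
  obtain ⟨U, hU⟩ := Matrix.exists_units_conj (e.symm.trans (AlgEquiv.ofBijective eσ hbij))
  refine ⟨U, fun d ↦ ?_⟩
  rw [← hU, ← hψσ]
  congr 1
  rw [AlgEquiv.trans_apply, e.symm_apply_apply, AlgEquiv.ofBijective_apply]
  refine Eq.symm ((Algebra.TensorProduct.lift_tmul _ _ _ _ _).trans ?_)
  rw [map_one, one_mul]

/-- The determinant of a generic linear combination of matrices is defined over the ground field if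
the family of matrices is equivalent to its Galois conjugates. -/
theorem exists_map_eq_det_sum_X_smul {Z Ω κ : Type*} [Field Z] [Field Ω] [Algebra Z Ω]
    [IsGalois Z Ω] [Fintype κ] {r : ℕ} (B : κ → Matrix (Fin r) (Fin r) Ω)
    (hB : ∀ σ : Gal(Ω/Z), ∃ U : (Matrix (Fin r) (Fin r) Ω)ˣ,
      ∀ i, (B i).map σ * (U : Matrix (Fin r) (Fin r) Ω) = U * B i) :
    ∃ Q : MvPolynomial κ Z, Q.IsHomogeneous r ∧
      ∀ x, algebraMap Z Ω (MvPolynomial.eval x Q) = (∑ i, x i • B i).det := by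
  let gen : Matrix (Fin r) (Fin r) (MvPolynomial κ Ω) :=
    ∑ i, (MvPolynomial.X i : MvPolynomial κ Ω) • (B i).map MvPolynomial.C
  have hgen : ∀ s t, gen s t = ∑ i, MvPolynomial.X i * MvPolynomial.C (B i s t) :=
    fun s t ↦ by simp [gen, Matrix.sum_apply]
  have hhom : gen.det.IsHomogeneous r := by
    have := Matrix.det_isHomogeneous gen (d := 1) fun s t ↦ by
      rw [hgen]
      refine MvPolynomial.IsHomogeneous.sum _ _ _ fun i _ ↦ ?_
      simpa using (MvPolynomial.isHomogeneous_X Ω i).mul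
        (MvPolynomial.isHomogeneous_C κ (B i s t))
    simpa using this
  have hinv : ∀ σ : Gal(Ω/Z), MvPolynomial.map (σ : Ω →+* Ω) gen.det = gen.det := fun σ ↦ by
    obtain ⟨U, hU⟩ := hB σ
    let UC := (U : Matrix (Fin r) (Fin r) Ω).map (MvPolynomial.C : Ω →+* MvPolynomial κ Ω)
    have h1 : gen.map (MvPolynomial.map (σ : Ω →+* Ω)) * UC = UC * gen := by
      have h2 : gen.map (MvPolynomial.map (σ : Ω →+* Ω)) =
          ∑ i, (MvPolynomial.X i : MvPolynomial _ Ω) • ((B i).map σ).map MvPolynomial.C := by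
        ext1 s t
        simp [hgen, Matrix.sum_apply]
      rw [h2, Finset.sum_mul, Finset.mul_sum]
      refine Finset.sum_congr rfl fun i _ ↦ ?_
      rw [Matrix.smul_mul, Matrix.mul_smul, ← Matrix.map_mul, ← Matrix.map_mul, hU]
    have h3 : IsUnit UC.det := by
      have : UC.det = MvPolynomial.C (U : Matrix (Fin r) (Fin r) Ω).det :=
        (RingHom.map_det _ _).symm
      rw [this]
      exact ((Matrix.isUnit_iff_isUnit_det _).1 U.isUnit).map _
    have h4 := congrArg Matrix.det h1
    rw [Matrix.det_mul, Matrix.det_mul, mul_comm] at h4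
    rw [RingHom.map_det]
    exact h3.mul_left_cancel h4
  obtain ⟨Q, hQ⟩ : ∃ Q, MvPolynomial.map (algebraMap Z Ω) Q = gen.det := by
    have : gen.det ∈ Set.range (MvPolynomial.map (σ := κ) (algebraMap Z Ω)) := by
      rw [MvPolynomial.mem_range_map_iff_coeffs_subset]
      intro c hc
      obtain ⟨s, -, rfl⟩ := MvPolynomial.mem_coeffs_iff.1 hc
      refine (InfiniteGalois.mem_range_algebraMap_iff_fixed _).2 fun σ ↦ ?_
      conv_rhs => rw [← hinv σ]
      rw [MvPolynomial.coeff_map]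
      rfl
    exact this
  refine ⟨Q, ?_, fun x ↦ ?_⟩
  · rw [← hQ] at hhom
    exact hhom.of_map (algebraMap Z Ω).injective
  · have h2 : MvPolynomial.eval (fun i ↦ algebraMap Z Ω (x i)) gen.det =
        algebraMap Z Ω (MvPolynomial.eval x Q) := by
      rw [← hQ, MvPolynomial.eval_map, MvPolynomial.eval, MvPolynomial.coe_eval₂Hom,
        MvPolynomial.hom_eval₂, RingHom.comp_id]
    rw [← h2, RingHom.map_det]
    congr 1
    ext s t
    simp only [RingHom.mapMatrix_apply, Matrix.map_apply, hgen, map_sum, map_mul,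
      MvPolynomial.eval_X, MvPolynomial.eval_C, Matrix.sum_apply, Matrix.smul_apply]
    exact Finset.sum_congr rfl fun i _ ↦ (Algebra.smul_def _ _).symm

/-- A central division algebra over a `C₁`-field is trivial: its reduced norm is a form of degree
`r` in `r ^ 2` variables without non-trivial zero. The reduced norm is constructed over a separable
closure, and descends since by the theorem of Skolem and Noether it is invariant under the Galois
group. -/
theorem IsC1Field.finrank_eq_one {Z D : Type*} [Field Z] (hZ : IsC1Field Z) [DivisionRing D]
    [Algebra Z D] [FiniteDimensional Z D] [Algebra.IsCentral Z D] : Module.finrank Z D = 1 := by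
  obtain ⟨r, hr, ⟨e⟩⟩ := exists_algEquiv_matrix_of_isSepClosed Z D (SeparableClosure Z)
  have hdim : Module.finrank Z D = r * r := by
    rw [← Module.finrank_baseChange (R := SeparableClosure Z), e.toLinearEquiv.finrank_eq]
    simp [Module.finrank_matrix]
  have : Nonempty (Fin r) := ⟨⟨0, hr⟩⟩
  let ψ : D →ₐ[Z] Matrix (Fin r) (Fin r) (SeparableClosure Z) :=
    (e.toAlgHom.restrictScalars Z).comp Algebra.TensorProduct.includeRight
  let b := Module.finBasis Z D
  obtain ⟨Q, hQ, hQeval⟩ := exists_map_eq_det_sum_X_smul (fun i ↦ ψ (b i)) fun σ ↦ by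
    obtain ⟨U, hU⟩ := exists_units_map_mul_eq e σ
    exact ⟨U, fun i ↦ hU (b i)⟩
  -- A non-trivial zero of the reduced norm would be a non-invertible element of `D`.
  have hr2 : ¬ r < r * r := fun hlt ↦ by
    obtain ⟨x, hx, hx0⟩ := hZ.exists_eval_eq_zero Q hr (by simpa [hdim] using hlt) hQ
    have hd : ∑ i, x i • b i ≠ 0 := fun h ↦ hx (funext fun i ↦
      Fintype.linearIndependent_iff.1 b.linearIndependent _ h i)
    have h1 : (ψ (∑ i, x i • b i)).det = 0 := by
      have := hQeval x
      rw [hx0, map_zero] at this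
      rw [this, map_sum]
      simp only [map_smul]
    have h3 : IsUnit (ψ (∑ i, x i • b i)) := (isUnit_iff_ne_zero.2 hd).map ψ
    exact ((Matrix.isUnit_iff_isUnit_det _).1 h3).ne_zero h1
  have : r = 1 := by
    by_contra h
    exact hr2 (by nlinarith [show 2 ≤ r by lia])
  rw [hdim, this]

/-- Finite-dimensional division algebras over `C₁`-fields are commutative. -/
theorem IsC1Field.mul_comm {F D : Type*} [Field F] (hF : IsC1Field F) [DivisionRing D]
    [Algebra F D] [FiniteDimensional F D] (x y : D) : x * y = y * x := by
  let Z := Subring.center D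
  let _ : Algebra F Z := ((algebraMap F D).codRestrict Z fun c ↦
    Subring.mem_center_iff.2 fun d ↦ (Algebra.commutes c d).symm).toAlgebra
  have : IsScalarTower F Z D := IsScalarTower.of_algebraMap_eq fun _ ↦ rfl
  have : FiniteDimensional F Z := FiniteDimensional.of_injective
    (IsScalarTower.toAlgHom F Z D).toLinearMap Subtype.val_injective
  have : Algebra.IsCentral Z D := ⟨fun z hz ↦ Algebra.mem_bot.2
    ⟨⟨z, Subring.mem_center_iff.2 (Subalgebra.mem_center_iff.1 hz)⟩, rfl⟩⟩
  have : FiniteDimensional Z D := Module.Finite.of_restrictScalars_finite F Z D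
  have hZ : IsC1Field Z := hF.of_finiteDimensional
  have h : (⊥ : Subalgebra Z D) = ⊤ := Subalgebra.bot_eq_top_of_finrank_eq_one hZ.finrank_eq_one
  have hx : x ∈ (⊥ : Subalgebra Z D) := by
    rw [h]
    trivial
  obtain ⟨z, rfl⟩ := Algebra.mem_bot.1 hx
  exact Algebra.commutes z y

end DivisionAlgebra

/-! ### Idempotents from a Galois action -/

section Descent

open Module.End in
/-- If a finite Galois extension `L / k` acts on an `Ω`-vector space, compatibly with some embedding
`ι₀ : L → Ω`, and the action is isomorphic to its Galois conjugates, then all embeddings occur with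
the same multiplicity, so `[L : k]` divides the dimension. -/
theorem finrank_dvd_finrank_of_semilinear {k L Ω V : Type*} [Field k] [Field L] [Algebra k L]
    [FiniteDimensional k L] [IsGalois k L] [Field Ω] [IsAlgClosed Ω] [Algebra k Ω]
    [AddCommGroup V] [Module Ω V] [Module k V] [IsScalarTower k Ω V] [FiniteDimensional Ω V]
    (ι₀ : L →ₐ[k] Ω) (μ : L →ₐ[k] Module.End Ω V) (u : Gal(L/k) → Module.End Ω V)
    (hinj : ∀ g, Function.Injective (u g)) (hu : ∀ g c, u g * μ c = μ (g c) * u g) :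
    Module.finrank k L ∣ Module.finrank Ω V := by
  classical
  let pb := Field.powerBasisOfFiniteOfSeparable k L
  let f : Module.End Ω V := μ pb.gen
  -- The eigenspaces of a primitive element, which the operators `u h` permute.
  let W : Gal(L/k) → Submodule Ω V := fun g ↦ eigenspace f (ι₀ (g pb.gen))
  have hW : ∀ g v, v ∈ W g → ∀ c, μ c v = ι₀ (g c) • v := fun g v hv c ↦ by
    have hc : c ∈ Algebra.adjoin k {pb.gen} := by
      rw [pb.adjoin_gen_eq_top]
      trivial
    induction hc using Algebra.adjoin_induction with
    | mem x hx =>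
      rw [Set.mem_singleton_iff.1 hx]
      exact mem_eigenspace_iff.1 hv
    | algebraMap r => simp [Module.algebraMap_end_apply]
    | add x y _ _ hx hy => simp only [map_add, LinearMap.add_apply, hx, hy, add_smul]
    | mul x y _ _ hx hy =>
      simp only [map_mul, Module.End.mul_apply, hx, hy, map_smul, mul_smul]
      rw [smul_comm]
  have haeval : Polynomial.aeval f ((minpoly k pb.gen).map (algebraMap k Ω)) = 0 := by
    rw [Polynomial.aeval_map_algebraMap, Polynomial.aeval_algHom_apply, minpoly.aeval, map_zero]
  have hsep : ((minpoly k pb.gen).map (algebraMap k Ω)).Separable :=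
    Polynomial.Separable.map (Algebra.IsSeparable.isSeparable k pb.gen)
  have htop : ⨆ g, W g = ⊤ := by
    rw [eq_top_iff, ← (isSemisimple_of_squarefree_aeval_eq_zero
      hsep.squarefree haeval).iSup_eigenspace_eq_top]
    refine iSup_le fun z ↦ ?_
    by_cases hz : eigenspace f z = ⊥
    · rw [hz]
      exact bot_le
    have hroot : ((minpoly k pb.gen).map (algebraMap k Ω)).IsRoot z := by
      have hz' : f.HasEigenvalue z := hz
      exact (isRoot_of_hasEigenvalue hz').dvd (minpoly.dvd Ω f haeval)
    obtain ⟨r, hr, rfl⟩ : ∃ r, (minpoly k pb.gen).aeval r = 0 ∧ ι₀ r = z := by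
      have hsplit : ((minpoly k pb.gen).map (algebraMap k L)).Splits :=
        Normal.splits inferInstance pb.gen
      have hmap : (minpoly k pb.gen).map (algebraMap k Ω) =
          ((minpoly k pb.gen).map (algebraMap k L)).map (ι₀ : L →+* Ω) := by
        rw [Polynomial.map_map, ι₀.comp_algebraMap]
      have hz' := (Polynomial.mem_roots hsep.ne_zero).2 hroot
      rw [hmap, hsplit.roots_map, Multiset.mem_map] at hz'
      obtain ⟨r, hr, hrz⟩ := hz'
      refine ⟨r, ?_, hrz⟩
      rw [Polynomial.mem_roots', Polynomial.IsRoot, Polynomial.eval_map_algebraMap] at hr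
      exact hr.2
    obtain ⟨g, hg⟩ := minpoly.exists_algEquiv_of_root' (Algebra.IsAlgebraic.isAlgebraic pb.gen) hr
    rw [← hg]
    exact le_iSup W g
  have hind : iSupIndep W := (eigenspaces_iSupIndep f).comp fun g h hgh ↦ by
    have := pb.algHom_ext (f := g.toAlgHom) (g := h.toAlgHom) (ι₀.injective hgh)
    exact AlgEquiv.ext fun c ↦ DFunLike.congr_fun this c
  have hle : ∀ g h : Gal(L/k), Module.finrank Ω (W g) ≤ Module.finrank Ω (W (g * h⁻¹)) :=
    fun g h ↦ by
      have hmap : ∀ v ∈ W g, u h v ∈ W (g * h⁻¹) := fun v hv ↦ by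
        rw [mem_eigenspace_iff]
        have h1 := LinearMap.congr_fun (hu h (h⁻¹ pb.gen)) v
        have h2 : h (h⁻¹ pb.gen) = pb.gen := h.apply_symm_apply pb.gen
        rw [mul_apply, mul_apply, hW g v hv, map_smul, h2] at h1
        exact h1.symm
      refine LinearMap.finrank_le_finrank_of_injective (f := (u h).restrict hmap) ?_
      intro x y hxy
      exact Subtype.ext (hinj h (congrArg Subtype.val hxy))
  have heq : ∀ g, Module.finrank Ω (W g) = Module.finrank Ω (W 1) := fun g ↦
    le_antisymm ((hle g g).trans_eq (by rw [mul_inv_cancel]))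
      ((hle 1 g⁻¹).trans_eq (by rw [inv_inv, one_mul]))
  have hint := DirectSum.isInternal_submodule_of_iSupIndep_of_iSup_eq_top hind htop
  have hsum := (LinearEquiv.ofBijective (DirectSum.coeLinearMap W) hint).finrank_eq
  rw [Module.finrank_directSum, Finset.sum_congr rfl fun g _ ↦ heq g, Finset.sum_const,
    Finset.card_univ, ← Nat.card_eq_fintype_card, IsGalois.card_aut_eq_finrank, smul_eq_mul] at hsum
  exact ⟨_, hsum.symm⟩

/-- A family of `n × n` matrix units in the ring of `d × d` matrices exists if `n ∣ d`. -/
theorem exists_matrixUnits_of_dvd (R : Type*) [Ring R] {n d : ℕ} (h : n ∣ d) :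
    ∃ η : Fin n → Fin n → Matrix (Fin d) (Fin d) R,
      (∀ s t w, η s t * η t w = η s w) ∧ (∀ s t t' w, t ≠ t' → η s t * η t' w = 0) ∧
      ∑ s, η s s = 1 := by
  obtain ⟨c, rfl⟩ := h
  let θ : Matrix (Fin n) (Fin n) (Matrix (Fin c) (Fin c) R) ≃+*
      Matrix (Fin (n * c)) (Fin (n * c)) R :=
    (Matrix.compRingEquiv (Fin n) (Fin c) R).trans
      (Matrix.reindexRingEquiv R finProdFinEquiv)
  refine ⟨fun s t ↦ θ (Matrix.single s t 1), fun s t w ↦ ?_, fun s t t' w htt ↦ ?_, ?_⟩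
  · rw [← map_mul, Matrix.single_mul_single_same, mul_one]
  · rw [← map_mul, Matrix.single_mul_single_of_ne _ _ _ _ htt, map_zero]
  · rw [← map_sum, Matrix.sum_single_one, map_one]

/-- Let `E` be a finite-dimensional algebra over a `C₁`-field `k`, containing a finite Galois
extension `L / k` whose automorphisms are all induced by units of `E`. Then `1` is a sum of
`[L : k]` orthogonal idempotents of `E` that are pairwise equivalent. Modulo the radical, `E` is a
product of matrix rings over fields, of sizes divisible by `[L : k]`, so there the idempotents come
from a system of matrix units; they lift since the radical is nilpotent. -/
theorem exists_completeOrthogonalIdempotents {k L E : Type*} [Field k] (hk : IsC1Field k) [Field L]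
    [Algebra k L] [FiniteDimensional k L] [IsGalois k L] [Ring E] [Algebra k E]
    [FiniteDimensional k E] (μ : L →ₐ[k] E) (u : Gal(L/k) → E) (hunit : ∀ g, IsUnit (u g))
    (hu : ∀ g c, u g * μ c = μ (g c) * u g) :
    ∃ e : Fin (Module.finrank k L) → E, CompleteOrthogonalIdempotents e ∧
      ∀ s t, ∃ y z : E, e s * y = y ∧ z * y = e t := by
  have : IsArtinianRing E := isArtinian_of_tower k inferInstance
  let J := Ring.jacobson E
  obtain ⟨q, D, d, _, _, _, _, ⟨θ⟩⟩ :=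
    IsSemisimpleRing.exists_algEquiv_pi_matrix_divisionRing_finite k (E ⧸ J)
  have hdvd : ∀ i, Module.finrank k L ∣ d i := fun i ↦ by
    let _ : Field (D i) := { (inferInstance : DivisionRing (D i)) with mul_comm := hk.mul_comm }
    let Ω := AlgebraicClosure L
    let ι₁ : D i →ₐ[k] Ω := IsAlgClosed.lift
    let ρ : E →ₐ[k] Module.End Ω (Fin (d i) → Ω) :=
      ((Matrix.toLinAlgEquiv' (R := Ω) (n := Fin (d i))).toAlgHom.restrictScalars k).comp
        (ι₁.mapMatrix.comp ((Pi.evalAlgHom k (fun i ↦ Matrix (Fin (d i)) (Fin (d i)) (D i)) i).comp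
          (θ.toAlgHom.comp (Ideal.Quotient.mkₐ k J))))
    have := finrank_dvd_finrank_of_semilinear (IsScalarTower.toAlgHom k L Ω) (ρ.comp μ)
      (fun g ↦ ρ (u g)) (fun g ↦ ((Module.End.isUnit_iff _).1 ((hunit g).map ρ)).1)
      fun g c ↦ by
        change ρ (u g) * ρ (μ c) = ρ (μ (g c)) * ρ (u g)
        rw [← map_mul, ← map_mul, hu]
    simpa using this
  choose η hη hη0 hη1 using fun i ↦ exists_matrixUnits_of_dvd (D i) (hdvd i)
  let ε : Fin (Module.finrank k L) → Fin (Module.finrank k L) → E ⧸ J := fun s t ↦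
    θ.symm fun i ↦ η i s t
  have hε : ∀ s t w, ε s t * ε t w = ε s w := fun s t w ↦ by
    rw [← map_mul]
    exact congrArg _ (funext fun i ↦ hη i s t w)
  have hε0 : ∀ s t t' w, t ≠ t' → ε s t * ε t' w = 0 := fun s t t' w h ↦ by
    rw [← map_mul, ← map_zero θ.symm]
    exact congrArg _ (funext fun i ↦ hη0 i s t t' w h)
  have hε1 : ∑ s, ε s s = 1 := by
    rw [← map_sum, ← map_one θ.symm]
    refine congrArg _ (funext fun i ↦ ?_)
    rw [Finset.sum_apply]
    exact hη1 i
  have hnil : ∀ x ∈ RingHom.ker (Ideal.Quotient.mk J), IsNilpotent x := fun x hx ↦ by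
    obtain ⟨r, hr⟩ := IsSemiprimaryRing.isNilpotent (R := E)
    rw [Ideal.mk_ker] at hx
    exact ⟨r, by simpa [J, hr] using Ideal.pow_mem_pow hx r⟩
  have hsurj : Function.Surjective (Ideal.Quotient.mk J) := Ideal.Quotient.mk_surjective
  obtain ⟨e, he, hem⟩ := CompleteOrthogonalIdempotents.lift_of_isNilpotent_ker
    (Ideal.Quotient.mk J) hnil (e := fun s ↦ ε s s)
    ⟨⟨fun s ↦ hε s s s, fun s t hst ↦ hε0 s s t t hst⟩, hε1⟩ fun s ↦ hsurj _
  have hem' : ∀ s, Ideal.Quotient.mk J (e s) = ε s s := fun s ↦ congrFun hem s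
  choose x hx using fun s t ↦ hsurj (ε s t)
  refine ⟨e, he, fun s t ↦ ?_⟩
  have hes : e s * e s = e s := he.idem s
  have het : e t * e t = e t := he.idem t
  -- Lifts of the matrix units, corrected by a unit of the form `1 +` nilpotent.
  let y := e s * x s t * e t
  let j := e t * x t s * y - e t
  have hj : IsNilpotent j := hnil j <| by
    rw [RingHom.mem_ker]
    simp only [j, y, map_sub, map_mul, hem', hx, hε, sub_self]
  obtain ⟨w, hw⟩ := hj.isUnit_one_add
  have hj1 : e t * j = j := by
    simp only [j, mul_sub, ← mul_assoc, het]
  have hj2 : j * e t = j := by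
    simp only [j, y, sub_mul, mul_assoc, het]
  refine ⟨y, w⁻¹.1 * (e t * x t s), by simp only [y, ← mul_assoc, hes], ?_⟩
  have h1 : e t * x t s * y = w * e t := by
    rw [hw, add_mul, one_mul, hj2]
    simp [j]
  rw [mul_assoc, h1, ← mul_assoc, Units.inv_mul, one_mul]

end Descent

/-! ### Descent along finite Galois extensions -/

section DescentModule

/-- Equivalent idempotents in the commutant of a family of operators split the space into
isomorphic summands. -/
theorem exists_submodule_equiv_pi {k ι M : Type*} [Field k] [AddCommGroup M] [Module k M]
    [FiniteDimensional k M] (x : ι → Module.End k M) {n : ℕ} (hn : 0 < n)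
    (e : Fin n → Subalgebra.centralizer k (Set.range x)) (he : CompleteOrthogonalIdempotents e)
    (heq : ∀ s t, ∃ y z : Subalgebra.centralizer k (Set.range x), e s * y = y ∧ z * y = e t) :
    ∃ (N : Submodule k M) (y : ι → Module.End k N) (Φ : M ≃ₗ[k] (Fin n → N)),
      ∀ i v, Φ (x i v) = fun s ↦ y i (Φ v s) := by
  have hcomm : ∀ (c : Subalgebra.centralizer k (Set.range x)) i v, x i (c.1 v) = c.1 (x i v) :=
    fun c i v ↦ LinearMap.congr_fun (Subalgebra.mem_centralizer_iff k |>.1 c.2 (x i) ⟨i, rfl⟩) v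
  have hmul : ∀ (a b : Subalgebra.centralizer k (Set.range x)) v, (a * b).1 v = a.1 (b.1 v) :=
    fun _ _ _ ↦ rfl
  let o : Fin n := ⟨0, hn⟩
  let N : Submodule k M := LinearMap.range (e o).1
  have hN : ∀ v ∈ N, (e o).1 v = v := by
    rintro _ ⟨v, rfl⟩
    rw [← hmul, he.idem o]
  have hNx : ∀ i, ∀ v ∈ N, x i v ∈ N := by
    rintro i _ ⟨v, rfl⟩
    exact ⟨x i v, (hcomm _ _ _).symm⟩
  have hsum : ∀ v, ∑ s, (e s).1 v = v := fun v ↦ by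
    have h := congrArg (fun c : Subalgebra.centralizer k (Set.range x) ↦ c.1 v) he.complete
    simpa using h
  choose y z hy hz using heq
  have hy' : ∀ s t v, (e s).1 ((y s t).1 v) = (y s t).1 v := fun s t v ↦ by rw [← hmul, hy]
  have hz' : ∀ s t v, (z s t).1 ((y s t).1 v) = (e t).1 v := fun s t v ↦ by rw [← hmul, hz]
  let Φ : M →ₗ[k] (Fin n → N) := LinearMap.pi fun s ↦
    ((y o s).1 ∘ₗ (e s).1).codRestrict N fun v ↦ ⟨_, hy' o s _⟩
  have hΦ : ∀ v s, (Φ v s : M) = (y o s).1 ((e s).1 v) := fun _ _ ↦ rfl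
  have hΦinj : Function.Injective Φ := (injective_iff_map_eq_zero Φ).2 fun v hv ↦ by
    rw [← hsum v]
    refine Finset.sum_eq_zero fun s _ ↦ ?_
    have h1 : (y o s).1 ((e s).1 v) = 0 := by rw [← hΦ, hv]; rfl
    have h2 := hz' o s ((e s).1 v)
    rw [h1, map_zero, ← hmul, he.idem s] at h2
    exact h2.symm
  let Ψ : (Fin n → N) →ₗ[k] M := ∑ s, (y s o).1 ∘ₗ N.subtype ∘ₗ LinearMap.proj s
  have hΨ : ∀ v, Ψ v = ∑ s, (y s o).1 (v s) := fun v ↦ by simp [Ψ]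
  have hΨinj : Function.Injective Ψ := (injective_iff_map_eq_zero Ψ).2 fun v hv ↦ by
    ext t
    have h1 : (e t).1 (Ψ v) = (y t o).1 (v t) := by
      rw [hΨ, map_sum, Finset.sum_eq_single t]
      · exact hy' t o _
      · intro s _ hst
        rw [← hy' s o, ← hmul, he.ortho (Ne.symm hst)]
        rfl
      · simp
    have h2 := hz' t o (v t)
    rw [← h1, hv, map_zero, map_zero, hN _ (v t).2] at h2
    exact h2.symm
  have hfin : Module.finrank k M = Module.finrank k (Fin n → N) :=
    le_antisymm (LinearMap.finrank_le_finrank_of_injective hΦinj)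
      (LinearMap.finrank_le_finrank_of_injective hΨinj)
  refine ⟨N, fun i ↦ (x i).restrict (hNx i), LinearEquiv.ofBijective Φ ⟨hΦinj,
    (LinearMap.injective_iff_surjective_of_finrank_eq_finrank hfin).1 hΦinj⟩, fun i v ↦ ?_⟩
  ext s
  change (y o s).1 ((e s).1 (x i v)) = x i ((y o s).1 ((e s).1 v))
  rw [hcomm, hcomm]

variable {k L : Type*} [Field k] [Field L] [Algebra k L]

/-- A `g`-semilinear automorphism is `k`-linear. -/
def semilinearToLinear {M : Type*} [AddCommGroup M] [Module L M] [Module k M]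
    [IsScalarTower k L M] {g : Gal(L/k)} (φ : M ≃+ M) (hφ : ∀ (c : L) v, φ (c • v) = g c • φ v) :
    M ≃ₗ[k] M :=
  { φ with map_smul' := fun a v ↦ by
            have := hφ (algebraMap k L a) v
            rwa [g.commutes, algebraMap_smul, algebraMap_smul] at this }

/-- The map `v ↦ (c ↦ ∑ g, φ g (c • v g))` from families indexed by the Galois group to
`L →ₗ[k] M` is bijective: it is injective by linear independence of the automorphisms of `L`, and
the dimensions agree. -/
theorem exists_equiv_linearMap [FiniteDimensional k L] [IsGalois k L] {M : Type*} [AddCommGroup M]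
    [Module L M] [Module k M] [IsScalarTower k L M] [FiniteDimensional L M]
    (φ : Gal(L/k) → M ≃+ M) (hφ : ∀ g (c : L) v, φ g (c • v) = g c • φ g v) :
    ∃ T : (Gal(L/k) → M) ≃ₗ[k] (L →ₗ[k] M), ∀ v c, T v c = ∑ g, φ g (c • v g) := by
  classical
  have : FiniteDimensional k M := Module.Finite.trans L M
  let T : (Gal(L/k) → M) →ₗ[k] (L →ₗ[k] M) := ∑ g, LinearMap.compRight k
    (semilinearToLinear (φ g) (hφ g)).toLinearMap ∘ₗ
      (LinearMap.flip (Algebra.lsmul k k M : L →ₐ[k] Module.End k M).toLinearMap) ∘ₗ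
        LinearMap.proj g
  have hT : ∀ v c, T v c = ∑ g, φ g (c • v g) := fun v c ↦ by
    simp only [T, LinearMap.sum_apply]
    rfl
  have hinj : Function.Injective T := (injective_iff_map_eq_zero T).2 fun v hv ↦ by
    let b := Module.finBasis L M
    have h1 : ∀ g, φ g (v g) = 0 := fun g ↦ by
      refine b.ext_elem fun i ↦ ?_
      have hli : LinearIndependent L (fun g : Gal(L/k) ↦ (g : L → L)) :=
        (linearIndependent_monoidHom L L).comp (fun g : Gal(L/k) ↦ ((g : L →+* L) : L →* L))
          fun g h hgh ↦ AlgEquiv.ext fun c ↦ DFunLike.congr_fun hgh c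
      have h2 := Fintype.linearIndependent_iff.1 hli (fun g ↦ b.repr (φ g (v g)) i) <| by
        ext c
        have h3 := hT v c
        rw [hv] at h3
        have h4 := congrArg (fun w ↦ b.repr w i) h3.symm
        simp only [hφ, map_sum, map_smul, Finsupp.finsetSum_apply, Finsupp.smul_apply,
          LinearMap.zero_apply, map_zero, Finsupp.zero_apply, smul_eq_mul] at h4
        rw [Finset.sum_apply, Pi.zero_apply, ← h4]
        exact Finset.sum_congr rfl fun g _ ↦ mul_comm _ _
      rw [h2 g]
      simp
    ext g
    exact (φ g).map_eq_zero_iff.1 (h1 g)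
  have hfin : Module.finrank k (Gal(L/k) → M) = Module.finrank k (L →ₗ[k] M) := by
    rw [Module.finrank_pi_fintype, Finset.sum_const, Finset.card_univ, ← Nat.card_eq_fintype_card,
      IsGalois.card_aut_eq_finrank, Module.finrank_linearMap, smul_eq_mul]
  exact ⟨LinearEquiv.ofBijective T ⟨hinj,
    (LinearMap.injective_iff_surjective_of_finrank_eq_finrank hfin).1 hinj⟩, hT⟩

/-- Galois-invariant modules over `L` that are isomorphic over `k` are isomorphic. Indeed
`L →ₗ[k] M`, on which `L` acts through the source, is a power of `M`, and depends on the
restriction of `M` to `k` only. -/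
theorem exists_linearEquiv_of_semilinear [FiniteDimensional k L] [IsGalois k L] {ι M M' : Type*}
    [AddCommGroup M] [Module L M] [Module k M] [IsScalarTower k L M] [FiniteDimensional L M]
    [AddCommGroup M'] [Module L M'] [Module k M'] [IsScalarTower k L M'] [FiniteDimensional L M']
    (x : ι → Module.End L M) (x' : ι → Module.End L M')
    (φ : Gal(L/k) → M ≃+ M) (hφ : ∀ g (c : L) v, φ g (c • v) = g c • φ g v)
    (hφx : ∀ g i v, φ g (x i v) = x i (φ g v))
    (φ' : Gal(L/k) → M' ≃+ M') (hφ' : ∀ g (c : L) v, φ' g (c • v) = g c • φ' g v)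
    (hφx' : ∀ g i v, φ' g (x' i v) = x' i (φ' g v))
    (f : M ≃ₗ[k] M') (hf : ∀ i v, f (x i v) = x' i (f v)) :
    ∃ F : M ≃ₗ[L] M', ∀ i v, F (x i v) = x' i (F v) := by
  obtain ⟨T, hT⟩ := exists_equiv_linearMap φ hφ
  obtain ⟨T', hT'⟩ := exists_equiv_linearMap φ' hφ'
  let Θ : (Gal(L/k) → M) ≃ₗ[k] (Gal(L/k) → M') :=
    T.trans ((LinearEquiv.congrRight f).trans T'.symm)
  have hΘ : ∀ v c, T' (Θ v) c = f (T v c) := fun v c ↦ by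
    simp only [Θ, LinearEquiv.trans_apply, LinearEquiv.apply_symm_apply]
    rfl
  have hTx : ∀ i v c, T (fun g ↦ x i (v g)) c = x i (T v c) := fun i v c ↦ by
    rw [hT, hT, map_sum]
    exact Finset.sum_congr rfl fun g _ ↦ by rw [← map_smul, hφx]
  have hTx' : ∀ i v c, T' (fun g ↦ x' i (v g)) c = x' i (T' v c) := fun i v c ↦ by
    rw [hT', hT', map_sum]
    exact Finset.sum_congr rfl fun g _ ↦ by rw [← map_smul, hφx']
  have hTc : ∀ (a : L) v c, T (a • v) c = T v (c * a) := fun a v c ↦ by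
    rw [hT, hT]
    exact Finset.sum_congr rfl fun g _ ↦ by rw [Pi.smul_apply, mul_smul]
  have hTc' : ∀ (a : L) v c, T' (a • v) c = T' v (c * a) := fun a v c ↦ by
    rw [hT', hT']
    exact Finset.sum_congr rfl fun g _ ↦ by rw [Pi.smul_apply, mul_smul]
  refine exists_equiv_of_pi_equiv_of_commute x x' (J := Gal(L/k))
    { Θ with map_smul' := fun a v ↦ T'.injective (LinearMap.ext fun c ↦ ?_) } fun i v ↦
      T'.injective (LinearMap.ext fun c ↦ ?_)
  · change T' (Θ (a • v)) c = T' (a • Θ v) c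
    rw [hΘ, hTc, hTc', hΘ]
  · change T' (Θ _) c = T' (fun g ↦ x' i (Θ v g)) c
    rw [hΘ, hTx, hTx', hΘ, hf]

/-- Descent along a finite Galois extension of a `C₁`-field: a module with operators that is
isomorphic to all its Galois conjugates is defined over the ground field. -/
theorem exists_baseChange_equiv (hk : IsC1Field k) [FiniteDimensional k L] [IsGalois k L]
    {ι M : Type*} [AddCommGroup M] [Module L M] [Module k M] [IsScalarTower k L M]
    [FiniteDimensional L M] (x : ι → Module.End L M)
    (φ : Gal(L/k) → M ≃+ M) (hφ : ∀ g (c : L) v, φ g (c • v) = g c • φ g v)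
    (hφx : ∀ g i v, φ g (x i v) = x i (φ g v)) :
    ∃ (N : Submodule k M) (y : ι → Module.End k N) (F : M ≃ₗ[L] L ⊗[k] N),
      ∀ i v, F (x i v) = (y i).baseChange L (F v) := by
  have : FiniteDimensional k M := Module.Finite.trans L M
  let xk : ι → Module.End k M := fun i ↦ (x i).restrictScalars k
  let E := Subalgebra.centralizer k (Set.range xk)
  have hE : ∀ f : Module.End k M, f ∈ E ↔ ∀ i v, x i (f v) = f (x i v) := fun f ↦ by
    rw [Subalgebra.mem_centralizer_iff]
    constructor
    · intro h i v
      exact LinearMap.congr_fun (h _ ⟨i, rfl⟩) v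
    · rintro h _ ⟨i, rfl⟩
      exact LinearMap.ext (h i)
  let μ : L →ₐ[k] E := (Algebra.lsmul k k M : L →ₐ[k] Module.End k M).codRestrict E fun c ↦
    (hE _).2 fun i v ↦ map_smul (x i) c v
  let u : Gal(L/k) → E := fun g ↦ ⟨(semilinearToLinear (φ g) (hφ g)).toLinearMap,
    (hE _).2 fun i v ↦ (hφx g i v).symm⟩
  let u' : Gal(L/k) → E := fun g ↦ ⟨(semilinearToLinear (φ g) (hφ g)).symm.toLinearMap,
    (hE _).2 fun i v ↦ (φ g).injective <| by
      rw [hφx]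
      exact ((congrArg (x i) ((φ g).apply_symm_apply v))).trans
        ((φ g).apply_symm_apply (x i v)).symm⟩
  have hunit : ∀ g, IsUnit (u g) := fun g ↦ ⟨⟨u g, u' g,
    Subtype.ext (LinearMap.ext fun v ↦ (φ g).apply_symm_apply v),
    Subtype.ext (LinearMap.ext fun v ↦ (φ g).symm_apply_apply v)⟩, rfl⟩
  obtain ⟨e, he, heq⟩ := exists_completeOrthogonalIdempotents hk μ u hunit fun g c ↦
    Subtype.ext (LinearMap.ext fun v ↦ hφ g c v)
  -- Over `k`, the module `M` is the `[L : k]`-th power of `N`, and so is `L ⊗[k] N`.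
  obtain ⟨N, y, Φ, hΦ⟩ := exists_submodule_equiv_pi xk Module.finrank_pos e he heq
  let b := Module.finBasis k L
  let Λ : L ⊗[k] N ≃ₗ[k] (Fin (Module.finrank k L) → N) :=
    (TensorProduct.equivFinsuppOfBasisLeft b).trans (Finsupp.linearEquivFunOnFinite k N _)
  have hΛ : ∀ i w, Λ ((y i).baseChange L w) = fun s ↦ y i (Λ w s) := fun i w ↦ by
    induction w with
    | zero => ext; simp
    | add w w' h h' =>
      rw [map_add, map_add, h, h', map_add]
      ext s
      simp
    | tmul c n =>
      ext s
      simp [Λ]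
  let f : M ≃ₗ[k] L ⊗[k] N := Φ.trans Λ.symm
  have hf : ∀ i v, f (x i v) = (y i).baseChange L (f v) := fun i v ↦ by
    apply Λ.injective
    rw [hΛ]
    simp only [f, LinearEquiv.trans_apply, LinearEquiv.apply_symm_apply]
    exact hΦ i v
  let φ' : Gal(L/k) → L ⊗[k] N ≃+ L ⊗[k] N := fun g ↦
    (TensorProduct.congr g.toLinearEquiv (LinearEquiv.refl k N)).toAddEquiv
  have hφt : ∀ g c n, φ' g (c ⊗ₜ n) = g c ⊗ₜ n := fun _ _ _ ↦ rfl
  obtain ⟨F, hF⟩ := exists_linearEquiv_of_semilinear x (fun i ↦ (y i).baseChange L) φ hφ hφx φ'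
    (fun g c v ↦ by
      induction v with
      | zero => simp
      | add v w hv hw => rw [smul_add, map_add, hv, hw, map_add, smul_add]
      | tmul a n => rw [TensorProduct.smul_tmul', hφt, hφt, TensorProduct.smul_tmul', smul_eq_mul,
          smul_eq_mul, map_mul])
    (fun g i v ↦ by
      induction v with
      | zero => simp
      | add v w hv hw => simp only [map_add, hv, hw]
      | tmul a n => rw [LinearMap.baseChange_tmul, hφt, hφt, LinearMap.baseChange_tmul]) f hf
  exact ⟨N, y, F, hF⟩

end DescentModule

/-! ### Simultaneous similarity of matrices -/

section SimultaneousSimilarity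

variable {ι m : Type*} [Fintype m] [DecidableEq m]

/-- Simultaneous similarity of two families of square matrices. -/
def AreSimilar {K : Type*} [Field K] (X Y : ι → Matrix m m K) : Prop :=
  ∃ P : (Matrix m m K)ˣ, ∀ i, P.1 * X i = Y i * P

namespace AreSimilar

variable {K L : Type*} [Field K] [Field L] {X Y Z : ι → Matrix m m K}

theorem refl (X : ι → Matrix m m K) : AreSimilar X X := ⟨1, fun i ↦ by simp⟩

theorem symm : AreSimilar X Y → AreSimilar Y X := by
  rintro ⟨P, hP⟩
  refine ⟨P⁻¹, fun i ↦ ?_⟩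
  rw [Units.inv_mul_eq_iff_eq_mul, ← mul_assoc, hP, mul_assoc, Units.mul_inv, mul_one]

theorem trans : AreSimilar X Y → AreSimilar Y Z → AreSimilar X Z := by
  rintro ⟨P, hP⟩ ⟨Q, hQ⟩
  exact ⟨Q * P, fun i ↦ by rw [Units.val_mul, mul_assoc, hP, ← mul_assoc, hQ, mul_assoc]⟩

theorem map (h : AreSimilar X Y) (f : K →+* L) :
    AreSimilar (fun i ↦ (X i).map f) (fun i ↦ (Y i).map f) := by
  obtain ⟨P, hP⟩ := h
  refine ⟨Units.map (f.mapMatrix : Matrix m m K →+* Matrix m m L) P, fun i ↦ ?_⟩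
  have := congrArg (f.mapMatrix : Matrix m m K →+* Matrix m m L) (hP i)
  rwa [map_mul, map_mul] at this

theorem of_linearEquiv (f : (m → K) ≃ₗ[K] (m → K))
    (hf : ∀ i v, f (Matrix.mulVec (X i) v) = Matrix.mulVec (Y i) (f v)) : AreSimilar X Y := by
  have h1 : LinearMap.toMatrix' f.toLinearMap * LinearMap.toMatrix' f.symm.toLinearMap = 1 := by
    rw [← LinearMap.toMatrix'_comp]
    simp
  refine ⟨⟨_, _, h1, mul_eq_one_comm.1 h1⟩, fun i ↦ Matrix.toLin'.injective ?_⟩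
  ext1 v
  rw [Matrix.toLin'_mul, Matrix.toLin'_mul, Matrix.toLin'_toMatrix']
  exact LinearMap.ext fun v ↦ hf i _

end AreSimilar

variable {k L : Type*} [Field k] [Field L] [Algebra k L]

/-- Similarity over a finite extension implies similarity: restricting scalars, the extended modules
become powers of the original ones. -/
theorem AreSimilar.of_map_of_finiteDimensional [FiniteDimensional k L] {X Y : ι → Matrix m m k}
    (h : AreSimilar (fun i ↦ (X i).map (algebraMap k L)) (fun i ↦ (Y i).map (algebraMap k L))) :
    AreSimilar X Y := by
  obtain ⟨P, hP⟩ := h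
  let b := Module.finBasis k L
  have : Nonempty (Fin (Module.finrank k L)) := ⟨⟨0, Module.finrank_pos⟩⟩
  -- Coordinates with respect to `b` identify `L ^ m`, over `k`, with a power of `k ^ m`.
  let R : (m → L) ≃ₗ[k] (Fin (Module.finrank k L) → m → k) :=
    { toFun := fun w j s ↦ b.repr (w s) j
      map_add' := fun v w ↦ by ext; simp
      map_smul' := fun c w ↦ by ext; simp
      invFun := fun w s ↦ ∑ j, w j s • b j
      left_inv := fun w ↦ by
        ext s
        exact b.sum_repr (w s)
      right_inv := fun w ↦ by
        ext j s
        simp [Finsupp.single_apply] }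
  have hR : ∀ (A : Matrix m m k) w,
      R ((A.map (algebraMap k L)).mulVec w) = fun j ↦ A.mulVec (R w j) := fun A w ↦ by
    ext j s
    change b.repr (∑ t, algebraMap k L (A s t) * w t) j = ∑ t, A s t * b.repr (w t) j
    rw [map_sum, Finsupp.finsetSum_apply]
    exact Finset.sum_congr rfl fun t _ ↦ by rw [← Algebra.smul_def, map_smul]; rfl
  have hPP : ∀ w, P.1.mulVec (P⁻¹.1.mulVec w) = w := fun w ↦ by
    rw [Matrix.mulVec_mulVec, Units.mul_inv, Matrix.one_mulVec]
  have hPP' : ∀ w, P⁻¹.1.mulVec (P.1.mulVec w) = w := fun w ↦ by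
    rw [Matrix.mulVec_mulVec, Units.inv_mul, Matrix.one_mulVec]
  let Q : (m → L) ≃ₗ[k] (m → L) :=
    LinearEquiv.ofLinearMap ((Matrix.mulVecLin P.1).restrictScalars k)
      ((Matrix.mulVecLin P⁻¹.1).restrictScalars k) (LinearMap.ext hPP) (LinearMap.ext hPP')
  have hQ : ∀ w, Q w = P.1.mulVec w := fun _ ↦ rfl
  obtain ⟨f, hf⟩ := exists_equiv_of_pi_equiv_of_commute (J := Fin (Module.finrank k L))
    (fun i ↦ Matrix.mulVecLin (X i)) (fun i ↦ Matrix.mulVecLin (Y i))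
    (R.symm.trans (Q.trans R)) fun i v ↦ by
      obtain ⟨w, rfl⟩ := R.surjective v
      have h1 : (fun j ↦ (X i).mulVec (R w j)) = R (((X i).map (algebraMap k L)).mulVec w) :=
        (hR _ _).symm
      simp only [Matrix.mulVecLin_apply, LinearEquiv.trans_apply, R.symm_apply_apply]
      rw [h1, R.symm_apply_apply, hQ, hQ, Matrix.mulVec_mulVec, hP, ← Matrix.mulVec_mulVec, hR]
  exact AreSimilar.of_linearEquiv f hf

theorem aeval_det_sum_X_smul {κ R : Type*} [Fintype κ] [CommRing R] [Algebra k R]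
    (B : κ → Matrix m m k) (z : κ → R) :
    MvPolynomial.aeval z
      (∑ α, (MvPolynomial.X α : MvPolynomial κ k) • (B α).map MvPolynomial.C).det =
      (∑ α, z α • (B α).map (algebraMap k R)).det := by
  rw [AlgHom.map_det]
  congr 1
  ext s t
  simp [Matrix.sum_apply]

/-- The theorem of Noether and Deuring: families of matrices over a field that are similar over
an extension field are similar. The intertwining matrices form a linear subspace defined over the
ground field, on which the determinant is a nonzero polynomial, so some invertible intertwiner has
entries in a finite extension. -/
theorem AreSimilar.of_map {X Y : ι → Matrix m m k}
    (h : AreSimilar (fun i ↦ (X i).map (algebraMap k L)) (fun i ↦ (Y i).map (algebraMap k L))) :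
    AreSimilar X Y := by
  classical
  obtain ⟨P, hP⟩ := h
  let β := Module.Basis.ofVectorSpace k L
  -- The coefficients `B α` of `P` in a `k`-basis of `L` intertwine `X` and `Y`.
  let B : Module.Basis.ofVectorSpaceIndex k L → Matrix m m k := fun α ↦ P.1.map fun c ↦ β.repr c α
  have hB : ∀ α i, B α * X i = Y i * B α := fun α i ↦ by
    ext s t
    have h1 := congrArg (fun c ↦ β.repr c α) (congrFun (congrFun (hP i) s) t)
    simp only [Matrix.mul_apply, Matrix.map_apply, map_sum, Finsupp.finsetSum_apply] at h1
    simp only [Matrix.mul_apply, B, Matrix.map_apply]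
    refine Eq.trans ?_ (h1.trans ?_)
    · exact Finset.sum_congr rfl fun u _ ↦ by
        rw [mul_comm (P.1 s u), ← Algebra.smul_def, map_smul, Finsupp.smul_apply, smul_eq_mul,
          mul_comm]
    · exact Finset.sum_congr rfl fun u _ ↦ by
        rw [← Algebra.smul_def, map_smul, Finsupp.smul_apply, smul_eq_mul]
  let S : Finset (Module.Basis.ofVectorSpaceIndex k L) :=
    Finset.univ.biUnion fun s : m ↦ Finset.univ.biUnion fun t : m ↦ (β.repr (P.1 s t)).support
  let gen : Matrix m m (MvPolynomial S k) :=
    ∑ α : S, (MvPolynomial.X α : MvPolynomial S k) • (B α).map MvPolynomial.C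
  have hPsum : P.1 = ∑ α : S, β α • (B α).map (algebraMap k L) := by
    ext s t
    rw [Matrix.sum_apply]
    simp only [Matrix.smul_apply, Matrix.map_apply, B, smul_eq_mul]
    conv_lhs => rw [← β.linearCombination_repr (P.1 s t)]
    rw [Finsupp.linearCombination_apply, Finset.sum_coe_sort S
      (fun α ↦ β α * algebraMap k L (β.repr (P.1 s t) α)), Finsupp.sum_of_support_subset (s := S)]
    · exact Finset.sum_congr rfl fun α _ ↦ by rw [Algebra.smul_def, mul_comm]
    · intro α hα
      simp only [S, Finset.mem_biUnion]
      exact ⟨s, Finset.mem_univ _, t, Finset.mem_univ _, hα⟩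
    · simp
  have hdet : gen.det ≠ 0 := by
    intro h0
    have h1 := aeval_det_sum_X_smul (fun α : S ↦ B α) fun α : S ↦ β α
    change MvPolynomial.aeval _ gen.det = _ at h1
    rw [h0, map_zero, ← hPsum] at h1
    exact ((Matrix.isUnit_iff_isUnit_det _).1 P.isUnit).ne_zero h1.symm
  obtain ⟨z, hz⟩ : ∃ z : S → AlgebraicClosure k, MvPolynomial.aeval z gen.det ≠ 0 := by
    by_contra! hcon
    apply hdet
    apply MvPolynomial.map_injective (algebraMap k (AlgebraicClosure k))
      (algebraMap k (AlgebraicClosure k)).injective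
    refine MvPolynomial.funext fun z ↦ ?_
    rw [map_zero, map_zero, MvPolynomial.eval_map, ← MvPolynomial.aeval_def, hcon]
  let k' := IntermediateField.adjoin k (Set.range z)
  have : FiniteDimensional k k' := IntermediateField.finiteDimensional_adjoin
    fun x _ ↦ Algebra.IsIntegral.isIntegral x
  let z' : S → k' := fun α ↦ ⟨z α, IntermediateField.subset_adjoin k _ ⟨α, rfl⟩⟩
  have hz' : MvPolynomial.aeval z' gen.det ≠ 0 := fun h0 ↦ hz <| by
    have h1 := congrArg (algebraMap k' (AlgebraicClosure k)) h0
    rwa [map_zero, ← MvPolynomial.aeval_algebraMap_apply] at h1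
  rw [aeval_det_sum_X_smul] at hz'
  have hunit : IsUnit (∑ α : S, z' α • (B α).map (algebraMap k k')) :=
    (Matrix.isUnit_iff_isUnit_det _).2 (isUnit_iff_ne_zero.2 hz')
  refine AreSimilar.of_map_of_finiteDimensional (L := k') ⟨hunit.unit, fun i ↦ ?_⟩
  rw [IsUnit.unit_spec, Finset.sum_mul, Finset.mul_sum]
  refine Finset.sum_congr rfl fun α _ ↦ ?_
  rw [Matrix.smul_mul, Matrix.mul_smul, ← Matrix.map_mul, ← Matrix.map_mul, hB]

/-- The semilinear automorphism `v ↦ P⁻¹ (g v)` of `m → L`. -/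
def semilinearOfUnit (g : Gal(L/k)) (P : (Matrix m m L)ˣ) : (m → L) ≃+ (m → L) where
  toFun v := P⁻¹.1.mulVec (g ∘ v)
  invFun v := g.symm ∘ (P.1.mulVec v)
  left_inv v := by
    change g.symm ∘ (P.1.mulVec (P⁻¹.1.mulVec (g ∘ v))) = v
    rw [Matrix.mulVec_mulVec, Units.mul_inv, Matrix.one_mulVec]
    ext s
    simp
  right_inv v := by
    have : g ∘ (g.symm ∘ (P.1.mulVec v)) = P.1.mulVec v := by
      ext s
      simp
    change P⁻¹.1.mulVec (g ∘ (g.symm ∘ (P.1.mulVec v))) = v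
    rw [this, Matrix.mulVec_mulVec, Units.inv_mul, Matrix.one_mulVec]
  map_add' v w := by
    rw [← Matrix.mulVec_add]
    congr 1
    ext s
    simp

theorem semilinearOfUnit_apply (g : Gal(L/k)) (P : (Matrix m m L)ˣ) (v : m → L) :
    semilinearOfUnit g P v = P⁻¹.1.mulVec (g ∘ v) := rfl

/-- If `L ^ m` with the operators `X i` is isomorphic to the scalar extension of `N` with the
operators `y i`, then `X` is similar to the matrices of the `y i`. -/
theorem areSimilar_map_toMatrix {N : Type*} [AddCommGroup N] [Module k N] (X : ι → Matrix m m L)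
    (c : Module.Basis m k N) (y : ι → Module.End k N) (F : (m → L) ≃ₗ[L] L ⊗[k] N)
    (hF : ∀ i v, F (Matrix.mulVecLin (X i) v) = (y i).baseChange L (F v)) :
    AreSimilar X fun i ↦ (LinearMap.toMatrix c c (y i)).map (algebraMap k L) := by
  let C := Algebra.TensorProduct.basis L c
  let f : (m → L) ≃ₗ[L] (m → L) := F.trans C.equivFun
  refine AreSimilar.of_linearEquiv f fun i v ↦ ?_
  have h1 : (LinearMap.toMatrix c c (y i)).map (algebraMap k L) =
      LinearMap.toMatrix C C ((y i).baseChange L) :=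
    (LinearMap.toMatrix_baseChange ..).symm
  have h2 := LinearMap.toMatrix_mulVec_repr C C ((y i).baseChange L) (F v)
  rw [← hF] at h2
  rw [h1]
  exact h2.symm

/-- Matrix form of `exists_baseChange_equiv`. -/
theorem exists_areSimilar_map_algebraMap (hk : IsC1Field k) [FiniteDimensional k L] [IsGalois k L]
    (X : ι → Matrix m m L) (hX : ∀ g : Gal(L/k), AreSimilar X fun i ↦ (X i).map g) :
    ∃ Y : ι → Matrix m m k, AreSimilar X fun i ↦ (Y i).map (algebraMap k L) := by
  choose P hP using hX
  have hPinv : ∀ g i, ((P g)⁻¹).1 * (X i).map g = X i * ((P g)⁻¹).1 := fun g i ↦ by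
    rw [Units.inv_mul_eq_iff_eq_mul, ← mul_assoc, hP, mul_assoc, Units.mul_inv, mul_one]
  obtain ⟨N, y, F, hF⟩ := exists_baseChange_equiv hk (fun i ↦ Matrix.mulVecLin (X i))
    (fun g ↦ semilinearOfUnit g (P g))
    (fun g c v ↦ by
      rw [semilinearOfUnit_apply, semilinearOfUnit_apply, ← Matrix.mulVec_smul]
      congr 1
      ext s
      simp)
    (fun g i v ↦ by
      have : (g ∘ (X i).mulVec v) = ((X i).map g).mulVec (g ∘ v) := by
        ext s
        simp [Matrix.mulVec, dotProduct]
      rw [Matrix.mulVecLin_apply, Matrix.mulVecLin_apply, semilinearOfUnit_apply,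
        semilinearOfUnit_apply, this, Matrix.mulVec_mulVec, Matrix.mulVec_mulVec, hPinv])
  have : FiniteDimensional k (m → L) := Module.Finite.trans L _
  have hdim : Module.finrank k N = Fintype.card m := by
    rw [← Module.finrank_baseChange (R := L), ← F.finrank_eq, Module.finrank_fintype_fun_eq_card]
  let c : Module.Basis m k N :=
    (Module.finBasisOfFinrankEq k N hdim).reindex (Fintype.equivFin m).symm
  exact ⟨_, areSimilar_map_toMatrix X c y F hF⟩

end SimultaneousSimilarity

/-! ### Fields of definition of families of matrices -/

section FieldOfDefinition

/-- The field generated by the entries is a field of definition. -/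
theorem exists_finiteDimensional_forall_mem {F K ι m : Type*} [Field F] [Field K]
    [Algebra F K] [Finite ι] [Finite m] [Algebra.IsAlgebraic F K] (X : ι → Matrix m m K) :
    ∃ K₀ : IntermediateField F K, FiniteDimensional F K₀ ∧ ∀ i s t, X i s t ∈ K₀ := by
  let S : Set K := Set.range fun p : ι × m × m ↦ X p.1 p.2.1 p.2.2
  exact ⟨IntermediateField.adjoin F S, IntermediateField.finiteDimensional_adjoin
    fun x _ ↦ Algebra.IsIntegral.isIntegral x,
    fun i s t ↦ IntermediateField.subset_adjoin F S ⟨(i, s, t), rfl⟩⟩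

variable {F K ι m : Type*} [Field F] [Field K] [Algebra F K] [Fintype m] [DecidableEq m]

/-- A family of matrices over `K` is defined over `K₀` if it is similar to a family of matrices with
entries in `K₀`. -/
def IsDefinedOver (X : ι → Matrix m m K) (K₀ : IntermediateField F K) : Prop :=
  ∃ Y : ι → Matrix m m K₀, AreSimilar X fun i ↦ (Y i).map (algebraMap K₀ K)

/-- The automorphisms `g` of `K / F` such that the family `X` is similar to its conjugate under
`g`. -/
def similarityStabilizer (F : Type*) [Field F] [Algebra F K] (X : ι → Matrix m m K) :
    Subgroup Gal(K/F) where
  carrier := {g | AreSimilar X fun i ↦ (X i).map g}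
  one_mem' := AreSimilar.refl X
  mul_mem' {g h} hg hh := by
    have h1 := AreSimilar.map hh (g : K →+* K)
    have h2 : (fun i ↦ ((X i).map h).map (g : K →+* K)) = fun i ↦ (X i).map (g * h) := by
      ext i s t
      rfl
    exact AreSimilar.trans hg (h2 ▸ h1)
  inv_mem' {g} hg := by
    have h1 := AreSimilar.map hg ((g⁻¹ : Gal(K/F)) : K →+* K)
    have h2 : (fun i ↦ ((X i).map g).map ((g⁻¹ : Gal(K/F)) : K →+* K)) = X := by
      ext i s t
      exact g.symm_apply_apply _
    exact (h2 ▸ h1).symm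

theorem mem_similarityStabilizer {X : ι → Matrix m m K} {g : Gal(K/F)} :
    g ∈ similarityStabilizer F X ↔ AreSimilar X fun i ↦ (X i).map g := Iff.rfl

theorem IsDefinedOver.of_forall_mem {X : ι → Matrix m m K} {K₀ : IntermediateField F K}
    (h : ∀ i s t, X i s t ∈ K₀) : IsDefinedOver X K₀ := by
  refine ⟨fun i ↦ Matrix.of fun s t ↦ ⟨X i s t, h i s t⟩, ?_⟩
  exact AreSimilar.refl X

theorem IsDefinedOver.fixingSubgroup_le {X : ι → Matrix m m K} {K₀ : IntermediateField F K}
    (h : IsDefinedOver X K₀) : K₀.fixingSubgroup ≤ similarityStabilizer F X := by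
  intro g hg
  obtain ⟨Y, hY⟩ := h
  have h1 := AreSimilar.map hY (g : K →+* K)
  have h2 : (fun i ↦ ((Y i).map (algebraMap K₀ K)).map (g : K →+* K)) =
      fun i ↦ (Y i).map (algebraMap K₀ K) := by
    ext i s t
    exact (IntermediateField.mem_fixingSubgroup_iff _ _).1 hg _ (Y i s t).2
  exact hY.trans (h2 ▸ h1).symm

theorem IsDefinedOver.fixedField_le [IsGalois F K] {X : ι → Matrix m m K}
    {K₀ : IntermediateField F K} (h : IsDefinedOver X K₀) :
    IntermediateField.fixedField (similarityStabilizer F X) ≤ K₀ := by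
  rw [← InfiniteGalois.fixedField_fixingSubgroup K₀]
  exact IntermediateField.fixedField_antitone h.fixingSubgroup_le

theorem finiteDimensional_of_le {K₀ K₁ : IntermediateField F K} (h : K₀ ≤ K₁)
    [FiniteDimensional F K₁] : FiniteDimensional F K₀ :=
  FiniteDimensional.of_injective (IntermediateField.inclusion h).toLinearMap
    (IntermediateField.inclusion h).injective

theorem finiteDimensional_fixedField_similarityStabilizer [Finite ι] [IsGalois F K]
    (X : ι → Matrix m m K) :
    FiniteDimensional F (IntermediateField.fixedField (similarityStabilizer F X)) := by
  obtain ⟨K₁, _, hX⟩ := exists_finiteDimensional_forall_mem (F := F) X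
  exact finiteDimensional_of_le (IsDefinedOver.of_forall_mem hX).fixedField_le

/-- The stabilizer is open, hence closed, as it contains the automorphisms fixing all entries. -/
theorem isClosed_similarityStabilizer [Finite ι] [Algebra.IsAlgebraic F K] (X : ι → Matrix m m K) :
    IsClosed (similarityStabilizer F X : Set Gal(K/F)) := by
  obtain ⟨K₁, _, hX⟩ := exists_finiteDimensional_forall_mem (F := F) X
  exact Subgroup.isClosed_of_isOpen _ (Subgroup.isOpen_mono
    (IsDefinedOver.of_forall_mem hX).fixingSubgroup_le K₁.fixingSubgroup_isOpen)

/-- Over a Galois extension of a `C₁`-field, a family of matrices is defined over the fixed field of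
its stabilizer. -/
theorem isDefinedOver_fixedField (hF : IsC1Field F) [Finite ι] [IsGalois F K]
    (X : ι → Matrix m m K) :
    IsDefinedOver X (IntermediateField.fixedField (similarityStabilizer F X)) := by
  set K₀ := IntermediateField.fixedField (similarityStabilizer F X) with hK₀
  have hfin : FiniteDimensional F K₀ := finiteDimensional_fixedField_similarityStabilizer X
  have hfix : K₀.fixingSubgroup = similarityStabilizer F X :=
    InfiniteGalois.fixingSubgroup_fixedField ⟨_, isClosed_similarityStabilizer X⟩
  let S : Set K := Set.range fun p : ι × m × m ↦ X p.1 p.2.1 p.2.2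
  let L := FiniteGaloisIntermediateField.adjoin K₀ S
  have hL : ∀ i s t, X i s t ∈ L.toIntermediateField := fun i s t ↦
    FiniteGaloisIntermediateField.subset_adjoin K₀ S ⟨(i, s, t), rfl⟩
  let X' : ι → Matrix m m L := fun i ↦ Matrix.of fun s t ↦ ⟨X i s t, hL i s t⟩
  have hX' : (fun i ↦ (X' i).map (algebraMap L K)) = X := rfl
  obtain ⟨Y, hY⟩ := exists_areSimilar_map_algebraMap hF.of_finiteDimensional X' fun g ↦ by
    let G : Gal(K/K₀) := g.liftNormal K
    have hG : G.restrictScalars F ∈ similarityStabilizer F X := by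
      rw [← hfix, IntermediateField.mem_fixingSubgroup_iff]
      exact fun x hx ↦ G.commutes ⟨x, hx⟩
    have h1 : (fun i ↦ (X i).map (G.restrictScalars F)) =
        fun i ↦ ((X' i).map g).map (algebraMap L K) := by
      ext i s t
      exact g.liftNormal_commutes K (X' i s t)
    rw [mem_similarityStabilizer, h1] at hG
    exact AreSimilar.of_map hG
  exact ⟨Y, hY.map (algebraMap L K)⟩

/-- Every family of matrices over a separable algebraic extension of a `C₁`-field has a minimal
field of definition, which is finite over the base: it is the one over a separable closure, which
lies in every field of definition, and over which similarity descends by `AreSimilar.of_map`. -/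
theorem exists_minimal_isDefinedOver (hF : IsC1Field F) [Finite ι] [Algebra.IsSeparable F K]
    (X : ι → Matrix m m K) :
    ∃ K₀ : IntermediateField F K, IsDefinedOver X K₀ ∧
      (∀ K₁ : IntermediateField F K, IsDefinedOver X K₁ → K₀ ≤ K₁) ∧ FiniteDimensional F K₀ := by
  let Ω := SeparableClosure K
  have : Algebra.IsSeparable F Ω := Algebra.IsSeparable.trans F K Ω
  have : IsSepClosure F Ω := ⟨inferInstance, inferInstance⟩
  let f : K →ₐ[F] Ω := IsScalarTower.toAlgHom F K Ω
  let X' : ι → Matrix m m Ω := fun i ↦ (X i).map (algebraMap K Ω)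
  obtain ⟨K', hfin, hdef, hmin⟩ : ∃ K' : IntermediateField F Ω, FiniteDimensional F K' ∧
      IsDefinedOver X' K' ∧
      ∀ K₁ : IntermediateField F K, IsDefinedOver X K₁ → K' ≤ K₁.map f := by
    refine ⟨_, finiteDimensional_fixedField_similarityStabilizer X',
      isDefinedOver_fixedField hF X', ?_⟩
    rintro K₁ ⟨Y, hY⟩
    refine IsDefinedOver.fixedField_le ⟨fun i ↦ (Y i).map fun c ↦ ⟨f c, c, c.2, rfl⟩, ?_⟩
    exact hY.map (algebraMap K Ω)
  obtain ⟨Y, hY⟩ := hdef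
  have hmem : ∀ z : K', ∃ c : K, f c = z := fun z ↦ by
    obtain ⟨c, -, hc⟩ := hmin ⊤ (IsDefinedOver.of_forall_mem fun _ _ _ ↦ trivial) z.2
    exact ⟨c, hc⟩
  choose r hr using hmem
  have hrmem : ∀ z : K', r z ∈ K'.comap f := fun z ↦ by
    change f (r z) ∈ K'
    rw [hr]
    exact z.2
  refine ⟨K'.comap f, ⟨fun i ↦ (Y i).map fun z ↦ ⟨r z, hrmem z⟩, ?_⟩, fun K₁ hK₁ c hc ↦ ?_, ?_⟩
  · refine AreSimilar.of_map (L := Ω) ?_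
    have h1 : (fun i ↦ (((Y i).map fun z ↦ (⟨r z, hrmem z⟩ : K'.comap f)).map
          (algebraMap (K'.comap f) K)).map (algebraMap K Ω)) =
        fun i ↦ (Y i).map (algebraMap K' Ω) := by
      funext i
      exact Matrix.ext fun s t ↦ hr _
    rw [h1]
    exact hY
  · obtain ⟨d, hd, hdc⟩ := hmin K₁ hK₁ hc
    rwa [← f.injective hdc]
  · let j : K'.comap f →ₐ[F] K' := (f.comp (K'.comap f).val).codRestrict K'.toSubalgebra fun x ↦ x.2
    exact FiniteDimensional.of_injective j.toLinearMap fun x y hxy ↦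
      Subtype.ext (f.injective (congrArg Subtype.val hxy))

end FieldOfDefinition

/-! ### Modules and their action matrices -/

section ModulesAndMatrices

theorem comp_mulVec {F K m : Type*} [Field F] [Field K] [Algebra F K] [Fintype m]
    (g : Gal(K/F)) (X : Matrix m m K) (v : m → K) :
    g ∘ X.mulVec v = (X.map g).mulVec (g ∘ v) := by
  ext s
  simp [Matrix.mulVec, dotProduct]

variable {F A K M ι m : Type*} [Field F] [Ring A] [Algebra F A] [Field K] [Algebra F K]
  [AddCommGroup M] [Module K M] [Module (K ⊗[F] A) M] [IsScalarTower K (K ⊗[F] A) M]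
  [Fintype m] [DecidableEq m]

/-- The matrix of the action of `a : A` on the `A_K`-module `M`, in a `K`-basis of `M`. -/
def actionMatrix (b : Module.Basis m K M) (a : A) : Matrix m m K :=
  LinearMap.toMatrix b b (Algebra.lsmul K K M ((1 : K) ⊗ₜ[F] a))

theorem equivFun_one_tmul_smul (b : Module.Basis m K M) (a : A) (x : M) :
    b.equivFun (((1 : K) ⊗ₜ[F] a) • x) = (actionMatrix (F := F) b a).mulVec (b.equivFun x) :=
  (LinearMap.toMatrix_mulVec_repr b b (Algebra.lsmul K K M ((1 : K) ⊗ₜ[F] a)) x).symm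

theorem equivFun_symm_mulVec (b : Module.Basis m K M) (a : A) (v : m → K) :
    b.equivFun.symm ((actionMatrix (F := F) b a).mulVec v) =
      ((1 : K) ⊗ₜ[F] a) • b.equivFun.symm v := by
  rw [LinearEquiv.symm_apply_eq, equivFun_one_tmul_smul, LinearEquiv.apply_symm_apply]

theorem tmul_smul_eq_smul_smul (k : K) (a : A) (x : M) :
    (k ⊗ₜ[F] a : K ⊗[F] A) • x = k • (((1 : K) ⊗ₜ[F] a) • x) := by
  rw [← smul_assoc, TensorProduct.smul_tmul', smul_eq_mul, mul_one]

theorem one_tmul_smul_smul (k : K) (a : A) (x : M) :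
    ((1 : K) ⊗ₜ[F] a) • (k • x) = k • (((1 : K) ⊗ₜ[F] a) • x) :=
  map_smul (Algebra.lsmul K K M ((1 : K) ⊗ₜ[F] a)) k x

/-- Stability of a subgroup of `M` that is closed under `F` may be checked on a basis of `A`. -/
theorem one_tmul_smul_mem (a : Module.Basis ι F A) {S : Type*} [SetLike S M] [AddSubgroupClass S M]
    {s : S} {x : M} (hs : ∀ (r : F), ∀ y ∈ s, algebraMap F K r • y ∈ s)
    (h : ∀ i, ((1 : K) ⊗ₜ[F] a i) • x ∈ s) (c : A) : ((1 : K) ⊗ₜ[F] c) • x ∈ s := by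
  induction a.mem_span c using Submodule.span_induction with
  | mem c hc =>
    obtain ⟨i, rfl⟩ := hc
    exact h i
  | zero =>
    rw [TensorProduct.tmul_zero, zero_smul]
    exact zero_mem s
  | add c d _ _ hc hd =>
    rw [TensorProduct.tmul_add, add_smul]
    exact add_mem hc hd
  | smul r c _ hc =>
    rw [← TensorProduct.smul_tmul, Algebra.smul_def, mul_one, tmul_smul_eq_smul_smul]
    exact hs r _ hc

theorem IsFieldOfDefinition.isDefinedOver {K₀ : IntermediateField F K}
    (h : IsFieldOfDefinition A M K₀) (b : Module.Basis m K M) (a : ι → A) :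
    IsDefinedOver (fun i ↦ actionMatrix (F := F) b (a i)) K₀ := by
  obtain ⟨M₀, _, _, _, _, ⟨e⟩⟩ := h
  let e' : M ≃ₗ[K] K ⊗[K₀] M₀ := e.restrictScalars K
  let c₀ := Module.Basis.ofVectorSpace K₀ M₀
  let c : Module.Basis m K₀ M₀ :=
    c₀.reindex (((Algebra.TensorProduct.basis K c₀).map e'.symm).indexEquiv b)
  refine ⟨_, areSimilar_map_toMatrix _ c
    (fun i ↦ Algebra.lsmul K₀ K₀ M₀ ((1 : K₀) ⊗ₜ[F] a i)) (b.equivFun.symm.trans e') fun i v ↦ ?_⟩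
  rw [Matrix.mulVecLin_apply, LinearEquiv.trans_apply, equivFun_symm_mulVec,
    LinearEquiv.trans_apply]
  generalize b.equivFun.symm v = x
  have h1 : e' (((1 : K) ⊗ₜ[F] a i) • x) = baseChangeAction F A K₀ K M₀ (1 ⊗ₜ a i) (e' x) :=
    e.map_smul _ x
  rw [h1]
  induction e' x with
  | zero => simp
  | add y z hy hz => rw [map_add, map_add, hy, hz]
  | tmul l n =>
    rw [baseChangeAction_tmul_tmul, one_mul]
    rfl

/-- If `A` acts on a basis of `M` by matrices over `K₀`, then the `K₀`-span of the basis is an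
`A_{K₀}`-module whose extension to `K` is `M`. -/
theorem isFieldOfDefinition_of_basis (a : Module.Basis ι F A) (b : Module.Basis m K M)
    {K₀ : IntermediateField F K} (h : ∀ i s t, actionMatrix (F := F) b (a i) s t ∈ K₀) :
    IsFieldOfDefinition A M K₀ := by
  let N := Submodule.span K₀ (Set.range b)
  let θ : K₀ ⊗[F] A →ₐ[K₀] K ⊗[F] A :=
    Algebra.TensorProduct.map (Algebra.ofId K₀ K) (AlgHom.id F A)
  let : Module (K₀ ⊗[F] A) M := Module.compHom M θ.toRingHom
  have : IsScalarTower K₀ (K₀ ⊗[F] A) M := ⟨fun k z x ↦ by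
    change θ (k • z) • x = (k : K) • (θ z • x)
    rw [map_smul, ← smul_assoc]
    rfl⟩
  have hbN : ∀ i t, ((1 : K) ⊗ₜ[F] a i) • b t ∈ N := fun i t ↦ by
    have h1 : ((1 : K) ⊗ₜ[F] a i) • b t =
        ∑ s, (⟨actionMatrix (F := F) b (a i) s t, h i s t⟩ : K₀) • b s := by
      refine (b.sum_repr _).symm.trans (Finset.sum_congr rfl fun s _ ↦ ?_)
      exact congrArg (· • b s) (LinearMap.toMatrix_apply b b
        (Algebra.lsmul K K M ((1 : K) ⊗ₜ[F] a i)) s t).symm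
    rw [h1]
    exact sum_mem fun s _ ↦ N.smul_mem _ (Submodule.subset_span ⟨s, rfl⟩)
  have hN : ∀ (c : A), ∀ x ∈ N, ((1 : K) ⊗ₜ[F] c) • x ∈ N := fun c x hx ↦ by
    induction hx using Submodule.span_induction with
    | mem x hx =>
      obtain ⟨t, rfl⟩ := hx
      exact one_tmul_smul_mem a (fun r y hy ↦ N.smul_mem (algebraMap F K₀ r) hy)
        (fun i ↦ hbN i t) c
    | zero =>
      rw [smul_zero]
      exact zero_mem N
    | add x y _ _ hx hy =>
      rw [smul_add]
      exact add_mem hx hy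
    | smul k x _ hx =>
      have := one_tmul_smul_smul (F := F) (k : K) c x
      exact this ▸ N.smul_mem k hx
  have hθN : ∀ (z : K₀ ⊗[F] A), ∀ x ∈ N, θ z • x ∈ N := fun z x hx ↦ by
    induction z with
    | zero =>
      rw [map_zero, zero_smul]
      exact zero_mem N
    | add y z hy hz =>
      rw [map_add, add_smul]
      exact add_mem hy hz
    | tmul k c =>
      have h1 : θ (k ⊗ₜ c) = (k : K) ⊗ₜ c := rfl
      rw [h1, tmul_smul_eq_smul_smul (k : K)]
      exact N.smul_mem k (hN c x hx)
  let M₀ : Submodule (K₀ ⊗[F] A) M :=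
    { N.toAddSubmonoid with smul_mem' := fun z x hx ↦ hθN z x hx }
  let c : Module.Basis m K₀ M₀ := Module.Basis.span (b.linearIndependent.restrict_scalars' K₀)
  have hc : ∀ t, (c t : M) = b t := fun t ↦ congrArg Subtype.val (Module.Basis.span_apply _ t)
  let f : K ⊗[K₀] M₀ →ₗ[K] M := LinearMap.liftBaseChange K (M₀.subtype.restrictScalars K₀)
  have hf : f = ((Algebra.TensorProduct.basis K c).equiv b (Equiv.refl m)).toLinearMap := by
    refine (Algebra.TensorProduct.basis K c).ext fun t ↦ ?_
    rw [LinearEquiv.coe_coe, Module.Basis.equiv_apply, Algebra.TensorProduct.basis_apply]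
    simp [f, hc]
  have hfb : Function.Bijective f := by
    rw [hf]
    exact LinearEquiv.bijective _
  have hlin : ∀ (z : K ⊗[F] A) (y : K ⊗[K₀] M₀),
      f (baseChangeAction F A K₀ K M₀ z y) = z • f y := fun z y ↦ by
    induction z with
    | zero => rw [map_zero, LinearMap.zero_apply, map_zero, zero_smul]
    | add w z hw hz => rw [map_add, LinearMap.add_apply, map_add, hw, hz, add_smul]
    | tmul k c =>
      induction y with
      | zero => rw [map_zero, map_zero, smul_zero]
      | add w y hw hy => rw [map_add, map_add, hw, hy, map_add, smul_add]
      | tmul l n =>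
        rw [baseChangeAction_tmul_tmul]
        have h1 : f (l ⊗ₜ n) = l • (n : M) := LinearMap.liftBaseChange_tmul ..
        have h2 : f ((k * l) ⊗ₜ (((1 : K₀) ⊗ₜ[F] c) • n)) =
          (k * l) • (((1 : K) ⊗ₜ[F] c) • (n : M)) := LinearMap.liftBaseChange_tmul ..
        rw [h1, h2, tmul_smul_eq_smul_smul k, one_tmul_smul_smul, mul_smul]
  let e : ScalarExt K₀ K M₀ →ₗ[K ⊗[F] A] M :=
    { toFun := f
      map_add' := map_add f
      map_smul' := hlin }
  exact ⟨M₀, inferInstance, inferInstance, inferInstance, inferInstance,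
    ⟨(LinearEquiv.ofBijective e hfb).symm⟩⟩

theorem IsDefinedOver.isFieldOfDefinition {K₀ : IntermediateField F K} (b : Module.Basis m K M)
    (a : Module.Basis ι F A) (h : IsDefinedOver (fun i ↦ actionMatrix (F := F) b (a i)) K₀) :
    IsFieldOfDefinition A M K₀ := by
  obtain ⟨Y, P, hP⟩ := h
  let p : (m → K) ≃ₗ[K] (m → K) := Matrix.toLin'OfInv P.inv_mul P.mul_inv
  let b' : Module.Basis m K M := Module.Basis.ofEquivFun (b.equivFun.trans p)
  refine isFieldOfDefinition_of_basis a b' fun i s t ↦ ?_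
  suffices hs : actionMatrix (F := F) b' (a i) = (Y i).map (algebraMap K₀ K) by
    rw [hs]
    exact (Y i s t).2
  refine Matrix.toLin'.injective (LinearMap.ext fun v ↦ ?_)
  obtain ⟨x, rfl⟩ := b'.equivFun.surjective v
  have hb' : ∀ x, b'.equivFun x = P.1.mulVec (b.equivFun x) := fun x ↦ by
    rw [Module.Basis.equivFun_ofEquivFun]
    exact Matrix.toLin'_apply P.1 (b.equivFun x)
  rw [Matrix.toLin'_apply, Matrix.toLin'_apply, ← equivFun_one_tmul_smul, hb', hb',
    equivFun_one_tmul_smul, Matrix.mulVec_mulVec, Matrix.mulVec_mulVec, hP]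

theorem isFieldOfDefinition_iff (b : Module.Basis m K M) (a : Module.Basis ι F A)
    (K₀ : IntermediateField F K) :
    IsFieldOfDefinition A M K₀ ↔ IsDefinedOver (fun i ↦ actionMatrix (F := F) b (a i)) K₀ :=
  ⟨fun h ↦ h.isDefinedOver b a, fun h ↦ h.isFieldOfDefinition b a⟩

/-- In coordinates, a `g`-semilinear automorphism of `M` is `v ↦ P⁻¹ (g v)` with an invertible
matrix `P`, and it commutes with `A` if and only if `P` intertwines the action matrices with their
conjugates under `g`. -/
theorem galoisStabilizer_eq_similarityStabilizer (b : Module.Basis m K M)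
    (a : Module.Basis ι F A) :
    galoisStabilizer A M = similarityStabilizer F fun i ↦ actionMatrix (F := F) b (a i) := by
  ext g
  refine Iff.trans nonempty_galoisConj_equiv_iff (Iff.trans ?_ mem_similarityStabilizer.symm)
  constructor
  · rintro ⟨φ, hφ⟩
    have hK : ∀ (k : K) (x : M), φ (k • x) = g k • φ x := fun k x ↦ by
      have := hφ k 1 x
      rwa [tmul_smul_eq_smul_smul k, tmul_smul_eq_smul_smul (g k), ← Algebra.TensorProduct.one_def,
        one_smul, one_smul] at this
    have hA : ∀ (c : A) (x : M), φ (((1 : K) ⊗ₜ[F] c) • x) = ((1 : K) ⊗ₜ[F] c) • φ x :=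
      fun c x ↦ by rw [hφ, map_one]
    let f : (m → K) ≃+ (m → K) := (semilinearOfUnit g.symm (1 : (Matrix m m K)ˣ)).trans
      (b.equivFun.symm.toAddEquiv.trans (φ.trans b.equivFun.toAddEquiv))
    -- Undoing the semilinearity by `g⁻¹` turns `φ` into a linear automorphism of `K ^ m`.
    have hf : ∀ v, f (g ∘ v) = b.equivFun (φ (b.equivFun.symm v)) := fun v ↦ by
      have h1 : semilinearOfUnit g.symm (1 : (Matrix m m K)ˣ) (g ∘ v) = v := by
        rw [semilinearOfUnit_apply, inv_one, Units.val_one, Matrix.one_mulVec]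
        ext s
        simp
      change b.equivFun (φ (b.equivFun.symm
        (semilinearOfUnit g.symm (1 : (Matrix m m K)ˣ) (g ∘ v)))) = _
      rw [h1]
    have hg : ∀ v : m → K, ∃ w, g ∘ w = v := fun v ↦ ⟨g.symm ∘ v, by
      ext s
      simp⟩
    let f' : (m → K) ≃ₗ[K] (m → K) := { f with
      map_smul' := fun k v ↦ by
        obtain ⟨w, rfl⟩ := hg v
        obtain ⟨k, rfl⟩ := g.surjective k
        have h1 : g k • (g ∘ w) = g ∘ (k • w) := by
          ext s
          simp
        change f (g k • (g ∘ w)) = g k • f (g ∘ w)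
        rw [h1, hf, hf, map_smul, hK, map_smul] }
    refine (AreSimilar.of_linearEquiv f' fun i v ↦ ?_).symm
    obtain ⟨w, rfl⟩ := hg v
    change f _ = Matrix.mulVec _ (f _)
    rw [← comp_mulVec, hf, hf, equivFun_symm_mulVec, hA, equivFun_one_tmul_smul]
  · rintro ⟨P, hP⟩
    let φ : M ≃+ M := b.equivFun.toAddEquiv.trans
      ((semilinearOfUnit g P).trans b.equivFun.symm.toAddEquiv)
    have hφ : ∀ x, b.equivFun (φ x) = P⁻¹.1.mulVec (g ∘ b.equivFun x) := fun x ↦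
      b.equivFun.apply_symm_apply _
    have hPinv : ∀ i, P⁻¹.1 * (actionMatrix (F := F) b (a i)).map g =
        actionMatrix (F := F) b (a i) * P⁻¹.1 := fun i ↦ by
      rw [Units.inv_mul_eq_iff_eq_mul, ← mul_assoc, hP, mul_assoc, Units.mul_inv, mul_one]
    have hK : ∀ (k : K) (x : M), φ (k • x) = g k • φ x := fun k x ↦ b.equivFun.injective <| by
      rw [hφ, map_smul, map_smul, hφ, ← Matrix.mulVec_smul]
      congr 1
      ext s
      simp
    have hi : ∀ (i : ι) (x : M), φ (((1 : K) ⊗ₜ[F] a i) • x) = ((1 : K) ⊗ₜ[F] a i) • φ x :=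
      fun i x ↦ b.equivFun.injective <| by
        rw [hφ, equivFun_one_tmul_smul, equivFun_one_tmul_smul, comp_mulVec, hφ,
          Matrix.mulVec_mulVec, Matrix.mulVec_mulVec, hPinv]
    have hA : ∀ (c : A) (x : M), φ (((1 : K) ⊗ₜ[F] c) • x) = ((1 : K) ⊗ₜ[F] c) • φ x :=
      fun c x ↦ by
        induction a.mem_span c using Submodule.span_induction with
        | mem c hc =>
          obtain ⟨i, rfl⟩ := hc
          exact hi i x
        | zero => simp
        | add c d _ _ hc hd => rw [TensorProduct.tmul_add, add_smul, add_smul, map_add, hc, hd]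
        | smul r c _ hc =>
          rw [← TensorProduct.smul_tmul, Algebra.smul_def, mul_one,
            tmul_smul_eq_smul_smul (algebraMap F K r), tmul_smul_eq_smul_smul (algebraMap F K r),
            hK, hc, g.commutes]
    exact ⟨φ, fun k c x ↦ by
      rw [tmul_smul_eq_smul_smul k, hK, hA, ← tmul_smul_eq_smul_smul]⟩

end ModulesAndMatrices

end

theorem theorem1p1 {F A K M : Type*} [Field F] (hF : IsC1Field F)
    [Ring A] [Algebra F A] [Module.Finite F A]
    [Field K] [Algebra F K] [Algebra.IsAlgebraic F K] [Algebra.IsSeparable F K]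
    [AddCommGroup M] [Module K M] [Module (K ⊗[F] A) M] [IsScalarTower K (K ⊗[F] A) M]
    [Module.Finite (K ⊗[F] A) M] :
    ∃ K₀ : IntermediateField F K,
      IsMinimalFieldOfDefinition A M K₀ ∧
      (∀ K₁ : IntermediateField F K, IsMinimalFieldOfDefinition A M K₁ → K₁ = K₀) ∧
      FiniteDimensional F K₀ ∧
      (IsGalois F K → K₀ = IntermediateField.fixedField (galoisStabilizer A M)) := by
  have : Module.Finite K M := Module.Finite.trans (K ⊗[F] A) M
  let b := Module.finBasis K M
  let a := Module.finBasis F A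
  obtain ⟨K₀, h₀, hmin, hfin⟩ :=
    exists_minimal_isDefinedOver hF fun i ↦ actionMatrix (F := F) b (a i)
  have hK₀ : IsMinimalFieldOfDefinition A M K₀ :=
    ⟨(isFieldOfDefinition_iff b a K₀).2 h₀,
      fun L hL ↦ hmin L ((isFieldOfDefinition_iff b a L).1 hL)⟩
  refine ⟨K₀, hK₀, fun K₁ h₁ ↦ le_antisymm (h₁.2 K₀ hK₀.1) (hK₀.2 K₁ h₁.1), hfin, fun _ ↦ ?_⟩
  rw [galoisStabilizer_eq_similarityStabilizer b a]
  exact le_antisymm (hmin _ (isDefinedOver_fixedField hF _)) h₀.fixedField_le
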